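/- For a real number $p$ with $1<p<\infty$, let $J_p$ be the James space $$J_p=\Big\{x:\mathbb N\to\mathbb R \;:\; x(n)\to 0 \ \text{ and }\ \|x\|_{J_p}=\sup_{p_1<\dots<p_n}\Big(\sum_{i=1}^{n-1}|x(p_{i+1})-x(p_i)|^p\Big)^{1/p}<\infty\Big\},$$ where the supremum is over all finite strictly increasing sequences of natural numbers, normed by $\|\cdot\|_{J_p}$, and let $J_p\oplus J_q$ carry the norm $\|(x,y)\|=\max\{\|x\|_{J_p},\|y\|_{J_q}\}$. A metric space $(M,d)$ \emph{coarse Lipschitz embeds} into a metric space $(N,\delta)$ if there are a map $f:M\to N$ and constants $\theta,A,B>0$ such that for all $x,y\in M$, $$d(x,y)\ge\theta \ \Longrightarrow\ A\,d(x,y)\le\delta(f(x),f(y))\le B\,d(x,y).$$ Let $1<p<q<\infty$ and $1<r<\infty$ with $r\notin\{p,q\}$. Then $J_r$ does not coarse Lipschitz embed into $J_p\oplus J_q$. -/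

import Mathlib

noncomputable section

/-- The set of all numbers `(∑_{i < n} |x (s (i+1)) - x (s i)| ^ p) ^ (1/p)`, where `n` is a natural
number and `s 0 < s 1 < ... < s n` are natural numbers. (A finite increasing list of indices is
given as the initial part of a strictly increasing sequence `s`, which is no restriction.) -/
def jamesSums (p : ℝ) (x : ℕ → ℝ) : Set ℝ :=
  {a | ∃ (n : ℕ) (s : ℕ → ℕ), StrictMono s ∧
    a = (∑ i ∈ Finset.range n, |x (s (i + 1)) - x (s i)| ^ p) ^ (1 / p)}

theorem jamesSums_zero_mem (p : ℝ) (hp : 0 < p) (x : ℕ → ℝ) : (0 : ℝ) ∈ jamesSums p x :=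
  ⟨0, id, strictMono_id, by
    have h : (1 / p) ≠ 0 := by positivity
    simp only [Finset.range_zero, Finset.sum_empty]
    exact (Real.zero_rpow h).symm⟩

theorem jamesSums_nonneg {p : ℝ} {x : ℕ → ℝ} {a : ℝ} (h : a ∈ jamesSums p x) : 0 ≤ a := by
  obtain ⟨n, s, -, rfl⟩ := h
  positivity

theorem jamesSums_add_le {p : ℝ} (hp : 1 ≤ p) {x y : ℕ → ℝ} {a : ℝ}
    (h : a ∈ jamesSums p (x + y)) :
    ∃ b ∈ jamesSums p x, ∃ c ∈ jamesSums p y, a ≤ b + c := by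
  obtain ⟨n, s, hs, rfl⟩ := h
  refine ⟨_, ⟨n, s, hs, rfl⟩, _, ⟨n, s, hs, rfl⟩, ?_⟩
  have h := Real.Lp_add_le (Finset.range n) (fun i => x (s (i + 1)) - x (s i))
    (fun i => y (s (i + 1)) - y (s i)) hp
  convert h using 6
  simp only [Pi.add_apply]
  ring

theorem jamesSums_smul {p : ℝ} (hp : 0 < p) (c : ℝ) {x : ℕ → ℝ} {a : ℝ}
    (h : a ∈ jamesSums p x) : |c| * a ∈ jamesSums p (c • x) := by
  obtain ⟨n, s, hs, rfl⟩ := h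
  refine ⟨n, s, hs, ?_⟩
  have h1 : ∀ i, |(c • x) (s (i + 1)) - (c • x) (s i)| ^ p
      = |c| ^ p * |x (s (i + 1)) - x (s i)| ^ p := by
    intro i
    rw [← Real.mul_rpow (abs_nonneg _) (abs_nonneg _), ← abs_mul]
    simp only [Pi.smul_apply, smul_eq_mul, mul_sub]
  simp only [h1]
  rw [← Finset.mul_sum, Real.mul_rpow (by positivity) (by positivity), ← Real.rpow_mul
    (abs_nonneg c), mul_one_div_cancel hp.ne', Real.rpow_one]

theorem jamesSums_smul_inv {p : ℝ} (hp : 0 < p) (c : ℝ) {x : ℕ → ℝ} {a : ℝ}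
    (h : a ∈ jamesSums p (c • x)) : ∃ b ∈ jamesSums p x, a = |c| * b := by
  obtain ⟨n, s, hs, rfl⟩ := h
  refine ⟨_, ⟨n, s, hs, rfl⟩, ?_⟩
  have h1 : ∀ i, |(c • x) (s (i + 1)) - (c • x) (s i)| ^ p
      = |c| ^ p * |x (s (i + 1)) - x (s i)| ^ p := by
    intro i
    rw [← Real.mul_rpow (abs_nonneg _) (abs_nonneg _), ← abs_mul]
    simp only [Pi.smul_apply, smul_eq_mul, mul_sub]
  simp only [h1]
  rw [← Finset.mul_sum, Real.mul_rpow (by positivity) (by positivity), ← Real.rpow_mul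
    (abs_nonneg c), mul_one_div_cancel hp.ne', Real.rpow_one]

/-- The real sequences that tend to `0` and have finite James `p`-variation, as a linear
subspace of all real sequences. -/
def jamesSubmodule (p : ℝ) [hp : Fact (1 < p)] : Submodule ℝ (ℕ → ℝ) where
  carrier := {x | Filter.Tendsto x Filter.atTop (nhds 0) ∧ BddAbove (jamesSums p x)}
  zero_mem' := by
    refine ⟨tendsto_const_nhds, 0, ?_⟩
    rintro a ⟨n, s, -, rfl⟩
    have h1 : p ≠ 0 := by linarith [hp.out]
    have h2 : p⁻¹ ≠ 0 := inv_ne_zero h1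
    simp [Real.zero_rpow h1, Real.zero_rpow h2]
  add_mem' := by
    rintro x y ⟨hx, B, hB⟩ ⟨hy, C, hC⟩
    refine ⟨?_, B + C, ?_⟩
    · have h := hx.add hy
      rw [add_zero] at h
      exact h
    intro a ha
    obtain ⟨b, hb, c, hc, h⟩ := jamesSums_add_le hp.out.le ha
    linarith [hB hb, hC hc]
  smul_mem' := by
    rintro c x ⟨hx, B, hB⟩
    refine ⟨?_, |c| * B, ?_⟩
    · have h := hx.const_smul c
      rw [smul_zero] at h
      exact h
    intro a ha
    obtain ⟨b, hb, rfl⟩ := jamesSums_smul_inv (by linarith [hp.out]) c ha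
    exact mul_le_mul_of_nonneg_left (hB hb) (abs_nonneg c)

/-- The James space `J_p`, `1 < p < ∞`. It is a type synonym, so that it carries the James norm
defined below and not the topology of pointwise convergence. -/
def JamesSpace (p : ℝ) [Fact (1 < p)] : Type := ↥(jamesSubmodule p)

namespace JamesSpace

variable {p : ℝ} [hp : Fact (1 < p)]

instance : AddCommGroup (JamesSpace p) := inferInstanceAs (AddCommGroup ↥(jamesSubmodule p))

instance : Module ℝ (JamesSpace p) := inferInstanceAs (Module ℝ ↥(jamesSubmodule p))

/-- The sequence of coordinates of an element of `J_p`. -/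
def toSeq (x : JamesSpace p) : ℕ → ℝ := Subtype.val (p := fun y => y ∈ jamesSubmodule p) x

theorem toSeq_add (x y : JamesSpace p) : (x + y).toSeq = x.toSeq + y.toSeq := rfl

theorem toSeq_smul (c : ℝ) (x : JamesSpace p) : (c • x).toSeq = c • x.toSeq := rfl

theorem toSeq_zero : (0 : JamesSpace p).toSeq = 0 := rfl

theorem toSeq_injective : Function.Injective (toSeq : JamesSpace p → ℕ → ℝ) :=
  Subtype.val_injective

theorem tendsto_toSeq (x : JamesSpace p) : Filter.Tendsto x.toSeq Filter.atTop (nhds 0) :=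
  (Subtype.property (p := fun y => y ∈ jamesSubmodule p) x).1

theorem bddAbove (x : JamesSpace p) : BddAbove (jamesSums p x.toSeq) :=
  (Subtype.property (p := fun y => y ∈ jamesSubmodule p) x).2

/-- The James norm
`‖x‖ = sup_{s 0 < ... < s n} (∑_{i < n} |x (s (i+1)) - x (s i)| ^ p) ^ (1/p)`. -/
instance : Norm (JamesSpace p) := ⟨fun x => sSup (jamesSums p x.toSeq)⟩

theorem norm_def (x : JamesSpace p) : ‖x‖ = sSup (jamesSums p x.toSeq) := rfl

theorem isLUB_norm (x : JamesSpace p) : IsLUB (jamesSums p x.toSeq) ‖x‖ :=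
  isLUB_csSup ⟨0, jamesSums_zero_mem p (by linarith [hp.out]) _⟩ x.bddAbove

theorem eq_zero_of_norm_eq_zero (x : JamesSpace p) (h : ‖x‖ = 0) : x = 0 := by
  have hp0 : 0 < p := by linarith [hp.out]
  have hstep : ∀ m : ℕ, x.toSeq (m + 1) = x.toSeq m := by
    intro m
    have h1 := (isLUB_norm x).1 ⟨1, fun i => m + i, fun i j hij => by simpa using hij, rfl⟩
    rw [h] at h1
    simp only [Finset.range_one, Finset.sum_singleton, zero_add, add_zero] at h1
    rw [← Real.rpow_mul (abs_nonneg _), mul_one_div_cancel hp0.ne', Real.rpow_one] at h1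
    linarith [abs_nonpos_iff.mp h1]
  have hconst : ∀ m : ℕ, x.toSeq m = x.toSeq 0 := by
    intro m
    induction m with
    | zero => rfl
    | succ k ih => rw [hstep, ih]
  have hseq : x.toSeq = fun _ => x.toSeq 0 := funext hconst
  have hlim := x.tendsto_toSeq
  rw [hseq] at hlim
  have h0 : x.toSeq 0 = 0 := tendsto_nhds_unique tendsto_const_nhds hlim
  apply toSeq_injective
  rw [toSeq_zero, hseq, h0]
  rfl

theorem normCore (p : ℝ) [hp : Fact (1 < p)] : NormedSpace.Core ℝ (JamesSpace p) where
  norm_nonneg x := (isLUB_norm x).1 (jamesSums_zero_mem p (by linarith [hp.out]) _)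
  norm_smul c x := by
    have hp0 : 0 < p := by linarith [hp.out]
    refine (isLUB_norm (c • x)).unique ⟨?_, ?_⟩
    · intro a ha
      obtain ⟨b, hb, rfl⟩ := jamesSums_smul_inv hp0 c ha
      exact mul_le_mul_of_nonneg_left ((isLUB_norm x).1 hb) (abs_nonneg c)
    · intro B hB
      rcases eq_or_ne c 0 with rfl | hc
      · have h0 := hB (jamesSums_zero_mem p hp0 _)
        simpa using h0
      · have hc' : 0 < |c| := abs_pos.mpr hc
        rw [Real.norm_eq_abs, mul_comm, ← le_div_iff₀ hc']
        refine (isLUB_norm x).2 fun b hb => ?_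
        rw [le_div_iff₀ hc', mul_comm]
        exact hB (jamesSums_smul hp0 c hb)
  norm_triangle x y := by
    refine (isLUB_norm (x + y)).2 fun a ha => ?_
    obtain ⟨b, hb, c, hc, h⟩ := jamesSums_add_le hp.out.le ha
    linarith [(isLUB_norm x).1 hb, (isLUB_norm y).1 hc]
  norm_eq_zero_iff x := by
    refine ⟨eq_zero_of_norm_eq_zero x, ?_⟩
    rintro rfl
    refine (isLUB_norm (0 : JamesSpace p)).unique ⟨?_, ?_⟩
    · rintro a ⟨n, s, -, rfl⟩
      have h1 : p ≠ 0 := by linarith [hp.out]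
      have h2 : p⁻¹ ≠ 0 := inv_ne_zero h1
      simp [toSeq_zero, Real.zero_rpow h1, Real.zero_rpow h2]
    · intro B hB
      exact hB (jamesSums_zero_mem p (by linarith [hp.out]) _)

instance : NormedAddCommGroup (JamesSpace p) := NormedAddCommGroup.ofCore (normCore p)

instance : NormedSpace ℝ (JamesSpace p) := NormedSpace.ofCore (normCore p)

end JamesSpace

/-- `f` is a coarse Lipschitz embedding: it is bi-Lipschitz at large distances. -/
def IsCoarseLipschitzEmbedding {M N : Type*} [MetricSpace M] [MetricSpace N] (f : M → N) : Prop :=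
  ∃ θ A B : ℝ, 0 < θ ∧ 0 < A ∧ 0 < B ∧
    ∀ x y : M, θ ≤ dist x y → A * dist x y ≤ dist (f x) (f y) ∧ dist (f x) (f y) ≤ B * dist x y

/-- `M` coarse Lipschitz embeds into `N`. -/
def CoarseLipschitzEmbeds (M N : Type*) [MetricSpace M] [MetricSpace N] : Prop :=
  ∃ f : M → N, IsCoarseLipschitzEmbedding f

end

noncomputable section

open Filter Topology

/-! ### Sequences of bounded `p`-variation -/

theorem sum_abs_add_rpow_le {ι : Type*} (s : Finset ι) (f g : ι → ℝ) {p a b : ℝ} (hp : 1 ≤ p)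
    (ha : 0 ≤ a) (hb : 0 ≤ b) (hf : ∑ i ∈ s, |f i| ^ p ≤ a ^ p) (hg : ∑ i ∈ s, |g i| ^ p ≤ b ^ p) :
    ∑ i ∈ s, |f i + g i| ^ p ≤ (a + b) ^ p := by
  have hp0 : 0 < p := by linarith
  have key : ∀ (h : ι → ℝ) (c : ℝ), 0 ≤ c → ∑ i ∈ s, |h i| ^ p ≤ c ^ p →
      (∑ i ∈ s, |h i| ^ p) ^ (1 / p) ≤ c := by
    intro h c hc hh
    have := Real.rpow_le_rpow (by positivity) hh (by positivity : 0 ≤ 1 / p)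
    rwa [← Real.rpow_mul hc, mul_one_div_cancel hp0.ne', Real.rpow_one] at this
  have h1 : (∑ i ∈ s, |f i + g i| ^ p) ^ (1 / p) ≤ a + b :=
    (Real.Lp_add_le s f g hp).trans (add_le_add (key f a ha hf) (key g b hb hg))
  have h2 := Real.rpow_le_rpow (by positivity) h1 hp0.le
  rwa [← Real.rpow_mul (by positivity), one_div_mul_cancel hp0.ne', Real.rpow_one] at h2

/-- The sum of the `p`-th powers of the increments of `x` along the indices `s 0, ..., s n`. -/
def incrSum (p : ℝ) (x : ℕ → ℝ) (n : ℕ) (s : ℕ → ℕ) : ℝ :=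
  ∑ i ∈ Finset.range n, |x (s (i + 1)) - x (s i)| ^ p

theorem incrSum_nonneg (p : ℝ) (x : ℕ → ℝ) (n : ℕ) (s : ℕ → ℕ) : 0 ≤ incrSum p x n s :=
  Finset.sum_nonneg fun _ _ => by positivity

/-- The `p`-variation of the sequence `x` is at most `a`. -/
def VarLE (p a : ℝ) (x : ℕ → ℝ) : Prop :=
  0 ≤ a ∧ ∀ (n : ℕ) (s : ℕ → ℕ), Monotone s → incrSum p x n s ≤ a ^ p

theorem exists_strictMono_incrSum {p : ℝ} (hp : 0 < p) (x : ℕ → ℝ) (n : ℕ) (s : ℕ → ℕ)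
    (hs : Monotone s) :
    ∃ (m : ℕ) (t : ℕ → ℕ), StrictMono t ∧ t m = s n ∧ incrSum p x m t = incrSum p x n s := by
  induction n with
  | zero => exact ⟨0, fun i => s 0 + i, fun i j hij => by simpa using hij, by simp,
      by simp [incrSum]⟩
  | succ n ih =>
    obtain ⟨m, t, ht, htm, hsum⟩ := ih
    rcases (hs (Nat.le_succ n)).eq_or_lt with h | h
    · refine ⟨m, t, ht, htm.trans h, hsum.trans ?_⟩
      simp only [incrSum, Finset.sum_range_succ]
      have h' : s (n + 1) = s n := h.symm
      simp [h', Real.zero_rpow hp.ne']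
    · refine ⟨m + 1, fun i => if i ≤ m then t i else s (n + 1) + (i - (m + 1)), ?_, by simp, ?_⟩
      · refine strictMono_nat_of_lt_succ fun i => ?_
        rcases lt_trichotomy i m with hi | hi | hi
        · rw [if_pos hi.le, if_pos (by omega)]
          exact ht (Nat.lt_succ_self i)
        · subst hi
          rw [if_pos le_rfl, if_neg (by omega), htm]
          simp only [Nat.succ_eq_add_one] at h
          omega
        · rw [if_neg (by omega), if_neg (by omega)]
          omega
      · simp only [incrSum, Finset.sum_range_succ] at hsum ⊢
        congr 1
        · rw [← hsum]
          refine Finset.sum_congr rfl fun i hi => ?_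
          have hi' := Finset.mem_range.1 hi
          rw [if_pos hi'.le, if_pos (by omega)]
        · simp [htm]

theorem VarLE.mem_upperBounds {p a : ℝ} (hp : 0 < p) {x : ℕ → ℝ} (h : VarLE p a x) :
    a ∈ upperBounds (jamesSums p x) := by
  rintro b ⟨n, s, hs, rfl⟩
  have := Real.rpow_le_rpow (incrSum_nonneg p x n s) (h.2 n s hs.monotone)
    (by positivity : 0 ≤ 1 / p)
  rwa [← Real.rpow_mul h.1, mul_one_div_cancel hp.ne', Real.rpow_one] at this

theorem varLE_of_mem_upperBounds {p a : ℝ} (hp : 0 < p) {x : ℕ → ℝ}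
    (h : a ∈ upperBounds (jamesSums p x)) : VarLE p a x := by
  have ha : 0 ≤ a := h (jamesSums_zero_mem p hp x)
  refine ⟨ha, fun n s hs => ?_⟩
  obtain ⟨m, t, ht, -, hsum⟩ := exists_strictMono_incrSum hp x n s hs
  rw [← hsum]
  have h1 := Real.rpow_le_rpow (by positivity) (h ⟨m, t, ht, rfl⟩) hp.le
  rwa [← Real.rpow_mul (by positivity), one_div_mul_cancel hp.ne', Real.rpow_one] at h1

namespace VarLE

variable {p a b : ℝ} {x y : ℕ → ℝ}

theorem add (hp : 1 ≤ p) (hx : VarLE p a x) (hy : VarLE p b y) : VarLE p (a + b) (x + y) := by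
  refine ⟨add_nonneg hx.1 hy.1, fun n s hs => ?_⟩
  have := sum_abs_add_rpow_le (Finset.range n) (fun i => x (s (i + 1)) - x (s i))
    (fun i => y (s (i + 1)) - y (s i)) hp hx.1 hy.1 (hx.2 n s hs) (hy.2 n s hs)
  refine le_of_eq_of_le (Finset.sum_congr rfl fun i _ => ?_) this
  congr 2
  simp only [Pi.add_apply]
  ring

theorem neg (hx : VarLE p a x) : VarLE p a (-x) := by
  refine ⟨hx.1, fun n s hs => le_of_eq_of_le (Finset.sum_congr rfl fun i _ => ?_) (hx.2 n s hs)⟩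
  rw [← abs_neg]
  congr 2
  simp only [Pi.neg_apply]
  ring

theorem sub (hp : 1 ≤ p) (hx : VarLE p a x) (hy : VarLE p b y) : VarLE p (a + b) (x - y) := by
  rw [sub_eq_add_neg]
  exact hx.add hp hy.neg

theorem comp (hx : VarLE p a x) {u : ℕ → ℕ} (hu : Monotone u) : VarLE p a (x ∘ u) :=
  ⟨hx.1, fun n s hs => hx.2 n (u ∘ s) (hu.comp hs)⟩

theorem sub_const (hx : VarLE p a x) (c : ℝ) : VarLE p a (fun t => x t - c) :=
  ⟨hx.1, fun n s hs => le_of_eq_of_le (Finset.sum_congr rfl fun i _ => by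
    congr 2; ring) (hx.2 n s hs)⟩

theorem abs_sub_le (hp : 0 < p) (hx : VarLE p a x) (i j : ℕ) : |x j - x i| ≤ a := by
  wlog hij : i ≤ j generalizing i j
  · rw [abs_sub_comm]
    exact this j i (by omega)
  have h := hx.2 1 (fun k => if k = 0 then i else j) (by
    intro k l hkl
    dsimp only
    split_ifs <;> omega)
  simp only [incrSum, Finset.range_one, Finset.sum_singleton] at h
  exact (Real.rpow_le_rpow_iff (abs_nonneg _) hx.1 hp).1 (by simpa using h)

theorem abs_le_of_tendsto (hp : 0 < p) (hx : VarLE p a x) (h0 : Tendsto x atTop (𝓝 0)) (i : ℕ) :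
    |x i| ≤ a := by
  have h := (h0.sub_const (x i)).abs
  rw [zero_sub, abs_neg] at h
  exact le_of_tendsto' h fun j => hx.abs_sub_le hp i j

end VarLE

/-- Indices for the head and for the tail of a sequence can be concatenated. -/
theorem incrSum_head_add_tail_le (p : ℝ) (x : ℕ → ℝ) (R n m : ℕ) {s t : ℕ → ℕ} (hs : Monotone s)
    (ht : Monotone t) :
    ∃ (k : ℕ) (u : ℕ → ℕ), Monotone u ∧
      incrSum p (fun i => x (min i R)) n s + incrSum p (fun i => x (max i R)) m t
        ≤ incrSum p x k u := by
  refine ⟨n + 1 + m, fun i => if i ≤ n then min (s i) R else max (t (i - (n + 1))) R, ?_, ?_⟩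
  · refine monotone_nat_of_le_succ fun i => ?_
    rcases lt_trichotomy i n with hi | hi | hi
    · rw [if_pos hi.le, if_pos (by omega)]
      exact min_le_min_right _ (hs (Nat.le_succ i))
    · rw [if_pos hi.le, if_neg (by omega)]
      exact (min_le_right _ _).trans (le_max_right _ _)
    · rw [if_neg (by omega), if_neg (by omega)]
      exact max_le_max_right _ (ht (by omega))
  · simp only [incrSum]
    rw [Finset.sum_range_add, Finset.sum_range_succ]
    have h1 : ∀ i ∈ Finset.range n, |x (min (s (i + 1)) R) - x (min (s i) R)| ^ p =
        |x (if i + 1 ≤ n then min (s (i + 1)) R else max (t (i + 1 - (n + 1))) R) -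
          x (if i ≤ n then min (s i) R else max (t (i - (n + 1))) R)| ^ p := by
      intro i hi
      have hi' := Finset.mem_range.1 hi
      rw [if_pos (by omega), if_pos (by omega)]
    have h2 : ∀ i ∈ Finset.range m, |x (max (t (i + 1)) R) - x (max (t i) R)| ^ p =
        |x (if n + 1 + i + 1 ≤ n then min (s (n + 1 + i + 1)) R
            else max (t (n + 1 + i + 1 - (n + 1))) R) -
          x (if n + 1 + i ≤ n then min (s (n + 1 + i)) R
            else max (t (n + 1 + i - (n + 1))) R)| ^ p := by
      intro i hi
      rw [if_neg (by omega), if_neg (by omega)]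
      congr 6 <;> omega
    rw [Finset.sum_congr rfl h1, Finset.sum_congr rfl h2]
    have h3 := Real.rpow_nonneg (abs_nonneg (x (if n + 1 ≤ n then min (s (n + 1)) R
      else max (t (n + 1 - (n + 1))) R) - x (if n ≤ n then min (s n) R
        else max (t (n - (n + 1))) R))) p
    linarith

theorem VarLE.exists_tail {p a : ℝ} {x : ℕ → ℝ} (hx : VarLE p a x) {ε : ℝ}
    (hε : 0 < ε) : ∃ R : ℕ, VarLE p ε (fun i => x (max i R)) := by
  set S : Set ℝ := {c | ∃ (n : ℕ) (s : ℕ → ℕ), Monotone s ∧ c = incrSum p x n s} with hS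
  have hne : S.Nonempty := ⟨_, 0, id, monotone_id, rfl⟩
  have hbdd : BddAbove S := ⟨a ^ p, by rintro c ⟨n, s, hs, rfl⟩; exact hx.2 n s hs⟩
  have hlt : sSup S - ε ^ p < sSup S := by
    have := Real.rpow_pos_of_pos hε p
    linarith
  obtain ⟨_, ⟨n, s, hs, rfl⟩, hc⟩ := exists_lt_of_lt_csSup hne hlt
  refine ⟨s n, hε.le, fun m t ht => ?_⟩
  obtain ⟨k, u, hu, hle⟩ := incrSum_head_add_tail_le p x (s n) n m hs ht
  have h1 : incrSum p (fun i => x (min i (s n))) n s = incrSum p x n s := by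
    refine Finset.sum_congr rfl fun i hi => ?_
    have hi' := Finset.mem_range.1 hi
    dsimp only
    rw [min_eq_left (hs (show i + 1 ≤ n by omega)), min_eq_left (hs (show i ≤ n by omega))]
  have h2 : incrSum p x k u ≤ sSup S := le_csSup hbdd ⟨k, u, hu, rfl⟩
  linarith

namespace JamesSpace

variable {p : ℝ} [hp : Fact (1 < p)]

theorem one_lt (p : ℝ) [hp : Fact (1 < p)] : 1 < p := hp.out

theorem exp_pos (p : ℝ) [hp : Fact (1 < p)] : 0 < p := zero_lt_one.trans hp.out

theorem norm_le_iff {x : JamesSpace p} {a : ℝ} : ‖x‖ ≤ a ↔ VarLE p a x.toSeq := by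
  refine ⟨fun h => varLE_of_mem_upperBounds (exp_pos p) fun b hb => ?_, fun h => ?_⟩
  · exact ((isLUB_norm x).1 hb).trans h
  · exact (isLUB_norm x).2 (h.mem_upperBounds (exp_pos p))

theorem varLE (x : JamesSpace p) : VarLE p ‖x‖ x.toSeq := norm_le_iff.1 le_rfl

theorem abs_apply_le (x : JamesSpace p) (i : ℕ) : |x.toSeq i| ≤ ‖x‖ :=
  x.varLE.abs_le_of_tendsto (exp_pos p) x.tendsto_toSeq i

theorem norm_rpow_le {x : JamesSpace p} {b : ℝ}
    (h : ∀ (n : ℕ) (s : ℕ → ℕ), Monotone s → incrSum p x.toSeq n s ≤ b) : ‖x‖ ^ p ≤ b := by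
  have hb : 0 ≤ b := by simpa [incrSum] using h 0 id monotone_id
  have hpp := exp_pos p
  have : ‖x‖ ≤ b ^ (1 / p) := by
    refine norm_le_iff.2 ⟨by positivity, fun n s hs => ?_⟩
    rw [← Real.rpow_mul hb, one_div_mul_cancel hpp.ne', Real.rpow_one]
    exact h n s hs
  have h2 := Real.rpow_le_rpow (norm_nonneg x) this hpp.le
  rwa [← Real.rpow_mul hb, one_div_mul_cancel hpp.ne', Real.rpow_one] at h2

/-- The element of `J_p` with a given sequence of coordinates. -/
def ofSeq (x : ℕ → ℝ) (h0 : Tendsto x atTop (𝓝 0)) (hx : ∃ a, VarLE p a x) : JamesSpace p :=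
  (⟨x, h0, hx.imp fun _ h => h.mem_upperBounds (exp_pos p)⟩ : ↥(jamesSubmodule p))

theorem toSeq_sub (x y : JamesSpace p) : (x - y).toSeq = x.toSeq - y.toSeq := rfl

theorem toSeq_neg (x : JamesSpace p) : (-x).toSeq = -x.toSeq := rfl

theorem monotone_max (R : ℕ) : Monotone fun i : ℕ => max i R :=
  fun _ _ h => max_le_max_right _ h

theorem tendsto_max_atTop (R : ℕ) : Tendsto (fun i : ℕ => max i R) atTop atTop :=
  tendsto_atTop_mono (fun i => le_max_left i R) tendsto_id

/-- The projection of `J_p` that replaces the coordinates before `R` by the `R`-th one. -/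
def tail (R : ℕ) : JamesSpace p →ₗ[ℝ] JamesSpace p where
  toFun x := ofSeq (fun i => x.toSeq (max i R)) (x.tendsto_toSeq.comp (tendsto_max_atTop R))
    ⟨‖x‖, x.varLE.comp (monotone_max R)⟩
  map_add' _ _ := rfl
  map_smul' _ _ := rfl

theorem toSeq_tail (R : ℕ) (x : JamesSpace p) (i : ℕ) :
    (tail R x).toSeq i = x.toSeq (max i R) := rfl

theorem toSeq_sub_tail (R : ℕ) (x : JamesSpace p) (i : ℕ) :
    (x - tail R x).toSeq i = x.toSeq (min i R) - x.toSeq R := by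
  rw [toSeq_sub, Pi.sub_apply, toSeq_tail]
  rcases le_total i R with h | h
  · rw [max_eq_right h, min_eq_left h]
  · rw [max_eq_left h, min_eq_right h, sub_self, sub_self]

theorem norm_head_add_norm_tail_le (R : ℕ) (x : JamesSpace p) :
    ‖x - tail R x‖ ^ p + ‖tail R x‖ ^ p ≤ ‖x‖ ^ p := by
  have h1 : ‖x - tail R x‖ ^ p ≤ ‖x‖ ^ p - ‖tail R x‖ ^ p := by
    refine norm_rpow_le fun n s hs => ?_
    have h2 : ‖tail R x‖ ^ p ≤ ‖x‖ ^ p - incrSum p (x - tail R x).toSeq n s := by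
      refine norm_rpow_le fun m t ht => ?_
      obtain ⟨k, u, hu, hle⟩ := incrSum_head_add_tail_le p x.toSeq R n m hs ht
      have h3 : incrSum p (x - tail R x).toSeq n s
          = incrSum p (fun i => x.toSeq (min i R)) n s := by
        refine Finset.sum_congr rfl fun i _ => ?_
        rw [toSeq_sub_tail, toSeq_sub_tail, sub_sub_sub_cancel_right]
      have h4 := x.varLE.2 k u hu
      rw [h3]
      have h5 : incrSum p (tail R x).toSeq m t = incrSum p (fun i => x.toSeq (max i R)) m t := rfl
      linarith
    linarith
  linarith

theorem norm_tail_le (R : ℕ) (x : JamesSpace p) : ‖tail R x‖ ≤ ‖x‖ :=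
  norm_le_iff.2 (x.varLE.comp (monotone_max R))

theorem tail_tail {R S : ℕ} (h : R ≤ S) (x : JamesSpace p) : tail S (tail R x) = tail S x := by
  refine toSeq_injective (funext fun i => ?_)
  simp only [toSeq_tail, max_assoc, max_eq_left h]

theorem tendsto_norm_tail (x : JamesSpace p) :
    Tendsto (fun R => ‖tail R x‖) atTop (𝓝 0) := by
  rw [Metric.tendsto_atTop]
  intro ε hε
  obtain ⟨R, hR⟩ := x.varLE.exists_tail (half_pos hε)
  refine ⟨R, fun S hS => ?_⟩
  have h1 : ‖tail R x‖ ≤ ε / 2 := norm_le_iff.2 hR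
  have h2 := norm_tail_le S (tail R x)
  rw [tail_tail hS] at h2
  rw [Real.dist_eq, sub_zero, abs_of_nonneg (norm_nonneg _)]
  linarith

end JamesSpace

/-- The sequence that is `0` before `R` and `1` from `R` on. -/
def stepSeq (R : ℕ) : ℕ → ℝ := fun i => if R ≤ i then 1 else 0

theorem stepSeq_nonneg (R i : ℕ) : 0 ≤ stepSeq R i := by
  unfold stepSeq; split_ifs <;> norm_num

theorem stepSeq_le_one (R i : ℕ) : stepSeq R i ≤ 1 := by
  unfold stepSeq; split_ifs <;> norm_num

theorem stepSeq_mono (R : ℕ) : Monotone (stepSeq R) := by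
  intro i j hij
  unfold stepSeq
  split_ifs <;> first | omega | norm_num

theorem varLE_stepSeq {p : ℝ} (hp : 1 ≤ p) (R : ℕ) : VarLE p 1 (stepSeq R) := by
  refine ⟨zero_le_one, fun n s hs => ?_⟩
  rw [Real.one_rpow]
  have h1 : ∀ i, |stepSeq R (s (i + 1)) - stepSeq R (s i)| ^ p
      ≤ stepSeq R (s (i + 1)) - stepSeq R (s i) := by
    intro i
    have h2 := stepSeq_mono R (hs (Nat.le_succ i))
    have h3 := stepSeq_le_one R (s (i + 1))
    have h4 := stepSeq_nonneg R (s i)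
    simp only [Nat.succ_eq_add_one] at h2
    rw [abs_of_nonneg (by linarith)]
    refine (Real.rpow_le_rpow_of_exponent_ge' (by linarith) (by linarith) zero_le_one hp).trans ?_
    rw [Real.rpow_one]
  refine (Finset.sum_le_sum fun i _ => h1 i).trans ?_
  rw [Finset.sum_range_sub (fun i => stepSeq R (s i))]
  linarith [stepSeq_le_one R (s n), stepSeq_nonneg R (s 0)]

theorem single_eq_stepSeq_sub (i : ℕ) :
    (Pi.single i 1 : ℕ → ℝ) = stepSeq i - stepSeq (i + 1) := by
  funext j
  simp only [Pi.single_apply, Pi.sub_apply, stepSeq]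
  split_ifs <;> first | omega | norm_num

theorem varLE_single {p : ℝ} (hp : 1 ≤ p) (i : ℕ) : VarLE p 2 (Pi.single i 1 : ℕ → ℝ) := by
  rw [single_eq_stepSeq_sub]
  have := (varLE_stepSeq hp i).sub hp (varLE_stepSeq hp (i + 1))
  norm_num at this
  exact this

namespace JamesSpace

variable {p : ℝ} [hp : Fact (1 < p)]

/-- The unit vectors of `J_p`. -/
def basisVec (i : ℕ) : JamesSpace p :=
  ofSeq (Pi.single i 1) (tendsto_const_nhds.congr' (by
    filter_upwards [eventually_gt_atTop i] with j hj
    simp [hj.ne'])) ⟨2, varLE_single (one_lt p).le i⟩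

theorem toSeq_basisVec (i : ℕ) : (basisVec i : JamesSpace p).toSeq = Pi.single i 1 := rfl

theorem norm_basisVec_le (i : ℕ) : ‖(basisVec i : JamesSpace p)‖ ≤ 2 :=
  norm_le_iff.2 (varLE_single (one_lt p).le i)

/-- The coordinate functionals of `J_p`. -/
def coord (i : ℕ) : JamesSpace p →ₗ[ℝ] ℝ where
  toFun x := x.toSeq i
  map_add' _ _ := rfl
  map_smul' _ _ := rfl

theorem coord_apply (i : ℕ) (x : JamesSpace p) : coord i x = x.toSeq i := rfl

theorem sub_tail_eq_sum (R : ℕ) (x : JamesSpace p) :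
    x - tail R x = ∑ i ∈ Finset.range R, (x.toSeq i - x.toSeq R) • basisVec i := by
  refine toSeq_injective (funext fun j => ?_)
  rw [toSeq_sub_tail, ← coord_apply j (∑ _ ∈ _, _), map_sum]
  simp only [map_smul, coord_apply, toSeq_basisVec, smul_eq_mul, Pi.single_apply, mul_ite, mul_one,
    mul_zero, Finset.sum_ite_eq, Finset.mem_range]
  split_ifs with h
  · rw [min_eq_left h.le]
  · rw [min_eq_right (by omega), sub_self]

end JamesSpace

/-! ### Asymptotically uniformly convex seminorms -/

/-- The seminorm `ν` is asymptotically uniformly convex of power type `s` with respect to the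
projections `Q R` onto "tails", whose complementary projections have finite rank. -/
structure AsymptoticallyConvex {Z : Type*} [AddCommGroup Z] [Module ℝ Z] (s : ℝ)
    (ν : Seminorm ℝ Z) (Q : ℕ → Z →ₗ[ℝ] Z) : Prop where
  convex : ∀ R z, ν (z - Q R z) ^ s + ν (Q R z) ^ s ≤ ν z ^ s
  tendsto_tail : ∀ z, Tendsto (fun R => ν (Q R z)) atTop (𝓝 0)
  finite_rank : ∀ R, ∃ (ι : Type) (_ : Fintype ι) (c : ι → Z →ₗ[ℝ] ℝ) (C : ℝ), 0 ≤ C ∧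
    (∀ i z, |c i z| ≤ C * ν z) ∧ ∀ z, ν (z - Q R z) ≤ C * ∑ i, |c i z|

theorem rpow_add_rpow_le_of_le {a b c p s : ℝ} (ha : 0 ≤ a) (hb : 0 ≤ b) (hc : 0 ≤ c) (hp : 0 < p)
    (hps : p ≤ s) (h : a ^ p + b ^ p ≤ c ^ p) : a ^ s + b ^ s ≤ c ^ s := by
  have key : ∀ d : ℝ, 0 ≤ d → d ^ s = (d ^ p) ^ (s / p) := fun d hd => by
    rw [← Real.rpow_mul hd, mul_div_cancel₀ _ hp.ne']
  rw [key a ha, key b hb, key c hc]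
  refine (Real.add_rpow_le_rpow_add (by positivity) (by positivity)
    ((one_le_div hp).2 hps)).trans ?_
  exact Real.rpow_le_rpow (by positivity) h (div_nonneg (hp.le.trans hps) hp.le)

theorem asymptoticallyConvex_james {p s : ℝ} [Fact (1 < p)] (hps : p ≤ s) :
    AsymptoticallyConvex s (normSeminorm ℝ (JamesSpace p)) JamesSpace.tail where
  convex R z := rpow_add_rpow_le_of_le (apply_nonneg _ _) (apply_nonneg _ _) (apply_nonneg _ _)
    (JamesSpace.exp_pos p) hps (JamesSpace.norm_head_add_norm_tail_le R z)
  tendsto_tail z := JamesSpace.tendsto_norm_tail z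
  finite_rank R := by
    refine ⟨Fin R, inferInstance, fun i => JamesSpace.coord i - JamesSpace.coord R, 2,
      zero_le_two, ?_, ?_⟩
    · intro i z
      simp only [LinearMap.sub_apply, JamesSpace.coord_apply, coe_normSeminorm]
      have h1 := z.varLE.abs_sub_le (JamesSpace.exp_pos p) R i
      linarith [norm_nonneg z]
    · intro z
      simp only [LinearMap.sub_apply, JamesSpace.coord_apply, coe_normSeminorm]
      rw [JamesSpace.sub_tail_eq_sum, Finset.mul_sum,
        Fin.sum_univ_eq_sum_range (fun i => 2 * |z.toSeq i - z.toSeq R|) R]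
      refine norm_sum_le_of_le _ fun i _ => ?_
      rw [norm_smul, Real.norm_eq_abs, mul_comm]
      exact mul_le_mul_of_nonneg_right (JamesSpace.norm_basisVec_le i) (abs_nonneg _)

theorem asymptoticallyConvex_zero {Z : Type*} [AddCommGroup Z] [Module ℝ Z] :
    AsymptoticallyConvex 1 (0 : Seminorm ℝ Z) (fun _ => 0) where
  convex R z := by simp
  tendsto_tail z := by simp
  finite_rank R := ⟨Empty, inferInstance, fun _ => 0, 0, le_rfl, by simp, by simp⟩

/-- The `ℓ_s`-sum of two seminorms. -/
def lpSumSeminorm {Y Z : Type*} [AddCommGroup Y] [Module ℝ Y] [AddCommGroup Z] [Module ℝ Z]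
    (s : ℝ) (hs : 1 ≤ s) (ν : Seminorm ℝ Y) (μ : Seminorm ℝ Z) : Seminorm ℝ (Y × Z) :=
  Seminorm.of (fun z => (ν z.1 ^ s + μ z.2 ^ s) ^ (1 / s))
    (fun x y => by
      have hs0 : 0 < s := by linarith
      have h := Real.Lp_add_le_of_nonneg (f := ![ν x.1, μ x.2]) (g := ![ν y.1, μ y.2])
        Finset.univ hs (fun i _ => by fin_cases i <;> simp) (fun i _ => by fin_cases i <;> simp)
      simp only [Fin.sum_univ_two, Matrix.cons_val_zero, Matrix.cons_val_one] at h
      refine le_trans ?_ h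
      have h1 := map_add_le_add ν x.1 y.1
      have h2 := map_add_le_add μ x.2 y.2
      simp only [Prod.fst_add, Prod.snd_add]
      gcongr)
    (fun c x => by
      have hs0 : 0 < s := by linarith
      simp only [Prod.smul_fst, Prod.smul_snd, map_smul_eq_mul]
      rw [Real.mul_rpow (by positivity) (by positivity), Real.mul_rpow (by positivity)
        (by positivity), ← mul_add, Real.mul_rpow (by positivity) (by positivity),
        ← Real.rpow_mul (by positivity), mul_one_div_cancel hs0.ne', Real.rpow_one])

theorem lpSumSeminorm_rpow {Y Z : Type*} [AddCommGroup Y] [Module ℝ Y] [AddCommGroup Z]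
    [Module ℝ Z] {s : ℝ} (hs : 1 ≤ s) (ν : Seminorm ℝ Y) (μ : Seminorm ℝ Z) (z : Y × Z) :
    lpSumSeminorm s hs ν μ z ^ s = ν z.1 ^ s + μ z.2 ^ s := by
  have hs0 : 0 < s := by linarith
  have h : lpSumSeminorm s hs ν μ z = (ν z.1 ^ s + μ z.2 ^ s) ^ (1 / s) := rfl
  rw [h, ← Real.rpow_mul (by positivity), one_div_mul_cancel hs0.ne', Real.rpow_one]

section lpSum

variable {Y Z : Type*} [AddCommGroup Y] [Module ℝ Y] [AddCommGroup Z] [Module ℝ Z]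
  {s : ℝ} (hs : 1 ≤ s) (ν : Seminorm ℝ Y) (μ : Seminorm ℝ Z) (z : Y × Z)

theorem le_lpSumSeminorm_fst : ν z.1 ≤ lpSumSeminorm s hs ν μ z := by
  have hs0 : 0 < s := by linarith
  rw [← Real.rpow_le_rpow_iff (by positivity) (by positivity) hs0, lpSumSeminorm_rpow]
  linarith [Real.rpow_nonneg (apply_nonneg μ z.2) s]

theorem le_lpSumSeminorm_snd : μ z.2 ≤ lpSumSeminorm s hs ν μ z := by
  have hs0 : 0 < s := by linarith
  rw [← Real.rpow_le_rpow_iff (by positivity) (by positivity) hs0, lpSumSeminorm_rpow]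
  linarith [Real.rpow_nonneg (apply_nonneg ν z.1) s]

theorem lpSumSeminorm_le : lpSumSeminorm s hs ν μ z ≤ ν z.1 + μ z.2 := by
  have hs0 : 0 < s := by linarith
  rw [← Real.rpow_le_rpow_iff (by positivity) (by positivity) hs0, lpSumSeminorm_rpow]
  exact Real.add_rpow_le_rpow_add (by positivity) (by positivity) hs

theorem AsymptoticallyConvex.prod {ν : Seminorm ℝ Y} {μ : Seminorm ℝ Z} {Q : ℕ → Y →ₗ[ℝ] Y}
    {Q' : ℕ → Z →ₗ[ℝ] Z} (h : AsymptoticallyConvex s ν Q) (h' : AsymptoticallyConvex s μ Q') :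
    AsymptoticallyConvex s (lpSumSeminorm s hs ν μ) (fun R => (Q R).prodMap (Q' R)) where
  convex R z := by
    simp only [lpSumSeminorm_rpow, LinearMap.prodMap_apply, Prod.fst_sub, Prod.snd_sub]
    linarith [h.convex R z.1, h'.convex R z.2]
  tendsto_tail z := by
    have h1 := (h.tendsto_tail z.1).add (h'.tendsto_tail z.2)
    rw [add_zero] at h1
    exact squeeze_zero (fun R => apply_nonneg _ _) (fun R => lpSumSeminorm_le hs ν μ _) h1
  finite_rank R := by
    obtain ⟨ι, _, c, C, hC, hc, hP⟩ := h.finite_rank R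
    obtain ⟨κ, _, d, D, hD, hd, hP'⟩ := h'.finite_rank R
    refine ⟨ι ⊕ κ, inferInstance, Sum.elim (fun i => c i ∘ₗ LinearMap.fst ℝ Y Z)
      (fun i => d i ∘ₗ LinearMap.snd ℝ Y Z), C + D, by positivity, ?_, ?_⟩
    · rintro (i | i) z
      · refine (hc i z.1).trans ?_
        have := le_lpSumSeminorm_fst hs ν μ z
        gcongr
        linarith
      · refine (hd i z.2).trans ?_
        have := le_lpSumSeminorm_snd hs ν μ z
        gcongr
        linarith
    · intro z
      refine (lpSumSeminorm_le hs ν μ _).trans ?_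
      simp only [Fintype.sum_sum_type, Sum.elim_inl, Sum.elim_inr, LinearMap.comp_apply,
        LinearMap.fst_apply, LinearMap.snd_apply, mul_add]
      refine add_le_add ((hP z.1).trans ?_) ((hP' z.2).trans ?_)
      · gcongr
        linarith
      · gcongr
        linarith

end lpSum

/-! ### An asymptotically uniformly smooth renorming -/

/-- The increment sum of `x` along `s 0, ..., s n`, augmented by terms for both end points. -/
def endSum (p : ℝ) (x : ℕ → ℝ) (n : ℕ) (s : ℕ → ℕ) : ℝ :=
  incrSum p x n s + |2 * x (s 0)| ^ p + |2 * x (s n)| ^ p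

theorem endSum_nonneg (p : ℝ) (x : ℕ → ℝ) (n : ℕ) (s : ℕ → ℕ) : 0 ≤ endSum p x n s :=
  add_nonneg (add_nonneg (incrSum_nonneg _ _ _ _) (by positivity)) (by positivity)

/-- All sums `endSum p x n s` are at most `a ^ p`. -/
def EndVarLE (p a : ℝ) (x : ℕ → ℝ) : Prop :=
  0 ≤ a ∧ ∀ (n : ℕ) (s : ℕ → ℕ), Monotone s → endSum p x n s ≤ a ^ p

/-- The terms of `endSum` as a single finite family. -/
def endFamily (x : ℕ → ℝ) (n : ℕ) (s : ℕ → ℕ) (i : ℕ) : ℝ :=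
  if i < n then x (s (i + 1)) - x (s i) else if i = n then 2 * x (s 0) else 2 * x (s n)

theorem endSum_eq_sum_endFamily (p : ℝ) (x : ℕ → ℝ) (n : ℕ) (s : ℕ → ℕ) :
    endSum p x n s = ∑ i ∈ Finset.range (n + 2), |endFamily x n s i| ^ p := by
  rw [Finset.sum_range_succ, Finset.sum_range_succ]
  unfold endSum incrSum
  congr 1
  · congr 1
    · refine Finset.sum_congr rfl fun i hi => ?_
      rw [endFamily, if_pos (Finset.mem_range.1 hi)]
    · simp [endFamily]
  · simp [endFamily]

namespace EndVarLE

variable {p a b : ℝ} {x y : ℕ → ℝ}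

theorem mono (hp : 0 ≤ p) (h : EndVarLE p a x) (hab : a ≤ b) : EndVarLE p b x :=
  ⟨h.1.trans hab, fun n s hs => (h.2 n s hs).trans (Real.rpow_le_rpow h.1 hab hp)⟩

theorem add (hp : 1 ≤ p) (hx : EndVarLE p a x) (hy : EndVarLE p b y) :
    EndVarLE p (a + b) (x + y) := by
  refine ⟨add_nonneg hx.1 hy.1, fun n s hs => ?_⟩
  have hx' := hx.2 n s hs
  have hy' := hy.2 n s hs
  rw [endSum_eq_sum_endFamily] at hx' hy' ⊢
  refine le_of_eq_of_le (Finset.sum_congr rfl fun i _ => ?_)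
    (sum_abs_add_rpow_le _ _ _ hp hx.1 hy.1 hx' hy')
  congr 2
  simp only [endFamily, Pi.add_apply]
  split_ifs <;> ring

theorem smul (c : ℝ) (hx : EndVarLE p a x) : EndVarLE p (|c| * a) (c • x) := by
  refine ⟨mul_nonneg (abs_nonneg c) hx.1, fun n s hs => ?_⟩
  rw [Real.mul_rpow (abs_nonneg c) hx.1]
  refine le_of_eq_of_le ?_ (mul_le_mul_of_nonneg_left (hx.2 n s hs) (by positivity))
  rw [endSum_eq_sum_endFamily, endSum_eq_sum_endFamily, Finset.mul_sum]
  refine Finset.sum_congr rfl fun i _ => ?_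
  rw [← Real.mul_rpow (abs_nonneg _) (abs_nonneg _), ← abs_mul]
  congr 2
  simp only [endFamily, Pi.smul_apply, smul_eq_mul]
  split_ifs <;> ring

theorem neg (hx : EndVarLE p a x) : EndVarLE p a (-x) := by
  have := hx.smul (-1)
  simpa using this

theorem sub (hp : 1 ≤ p) (hx : EndVarLE p a x) (hy : EndVarLE p b y) :
    EndVarLE p (a + b) (x - y) := by
  rw [sub_eq_add_neg]
  exact hx.add hp hy.neg

theorem varLE (hx : EndVarLE p a x) : VarLE p a x := by
  refine ⟨hx.1, fun n s hs => le_trans ?_ (hx.2 n s hs)⟩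
  unfold endSum
  have h1 := Real.rpow_nonneg (abs_nonneg (2 * x (s 0))) p
  have h2 := Real.rpow_nonneg (abs_nonneg (2 * x (s n))) p
  linarith

theorem of_varLE (hp : 1 ≤ p) (hx : VarLE p a x) (hb : ∀ i, |x i| ≤ b) :
    EndVarLE p (a + 4 * b) x := by
  have hb0 : 0 ≤ b := (abs_nonneg _).trans (hb 0)
  have ha := hx.1
  refine ⟨by positivity, fun n s hs => ?_⟩
  have h1 : ∀ i, |2 * x i| ^ p ≤ (2 * b) ^ p := fun i => by
    rw [abs_mul, abs_two]
    have := hb i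
    gcongr
  have h2 := Real.add_rpow_le_rpow_add ha (by positivity : 0 ≤ 2 * b) hp
  have h3 := Real.add_rpow_le_rpow_add (by positivity : 0 ≤ a + 2 * b)
    (by positivity : 0 ≤ 2 * b) hp
  have h4 : a + 4 * b = a + 2 * b + 2 * b := by ring
  rw [h4]
  unfold endSum
  linarith [h1 (s 0), h1 (s n), hx.2 n s hs]

end EndVarLE

theorem endVarLE_stepSeq {p : ℝ} (hp : 1 ≤ p) (R : ℕ) : EndVarLE p 5 (stepSeq R) := by
  have := EndVarLE.of_varLE (b := 1) hp (varLE_stepSeq hp R) fun i => by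
    rw [abs_of_nonneg (stepSeq_nonneg R i)]
    exact stepSeq_le_one R i
  norm_num at this
  exact this

theorem endVarLE_single {p : ℝ} (hp : 1 ≤ p) (i : ℕ) :
    EndVarLE p 10 (Pi.single i 1 : ℕ → ℝ) := by
  rw [single_eq_stepSeq_sub]
  have := (endVarLE_stepSeq hp i).sub hp (endVarLE_stepSeq hp (i + 1))
  norm_num at this
  exact this

/-- The sequence that agrees with `D` before `R` and with `w` from `R` on. -/
def glue (R : ℕ) (D w : ℕ → ℝ) : ℕ → ℝ := fun i => if i < R then D i else w i

theorem incrSum_congr {p : ℝ} {x y : ℕ → ℝ} {n : ℕ} {s t : ℕ → ℕ}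
    (h : ∀ i ≤ n, x (s i) = y (t i)) : incrSum p x n s = incrSum p y n t := by
  refine Finset.sum_congr rfl fun i hi => ?_
  have hi' := Finset.mem_range.1 hi
  rw [h i (by omega), h (i + 1) (by omega)]

theorem endSum_congr {p : ℝ} {x y : ℕ → ℝ} {n : ℕ} {s t : ℕ → ℕ}
    (h : ∀ i ≤ n, x (s i) = y (t i)) : endSum p x n s = endSum p y n t := by
  unfold endSum
  rw [incrSum_congr h, h 0 (Nat.zero_le n), h n le_rfl]

theorem EndVarLE.glue {p a b c : ℝ} (hp : 1 ≤ p) {D w : ℕ → ℝ} (hD : EndVarLE p a D)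
    (hw : EndVarLE p b w) (hc : 0 ≤ c) (habc : a ^ p + b ^ p ≤ c ^ p) (R : ℕ) :
    EndVarLE p c (glue R D w) := by
  have ha := Real.rpow_nonneg hD.1 p
  have hb := Real.rpow_nonneg hw.1 p
  refine ⟨hc, fun n s hs => ?_⟩
  have hlt : ∀ i, s i < R → _root_.glue R D w (s i) = D (s i) := fun i hi => if_pos hi
  have hge : ∀ i, R ≤ s i → _root_.glue R D w (s i) = w (s i) :=
    fun i hi => if_neg (not_lt.2 hi)
  rcases lt_or_ge (s n) R with h | h
  · rw [endSum_congr fun i hi => hlt i ((hs hi).trans_lt h)]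
    linarith [hD.2 n s hs]
  rcases le_or_gt R (s 0) with h0 | h0
  · rw [endSum_congr fun i hi => hge i (h0.trans (hs (Nat.zero_le i)))]
    linarith [hw.2 n s hs]
  have hex : ∃ k, R ≤ s k := ⟨n, h⟩
  classical
  obtain ⟨k, hk, hmin⟩ : ∃ k, R ≤ s k ∧ ∀ j < k, s j < R :=
    ⟨Nat.find hex, Nat.find_spec hex, fun j hj => not_le.1 (Nat.find_min hex hj)⟩
  obtain ⟨l, rfl⟩ : ∃ l, k = l + 1 := Nat.exists_eq_succ_of_ne_zero (by rintro rfl; omega)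
  obtain ⟨m, rfl⟩ : ∃ m, n = l + 1 + m := Nat.exists_eq_add_of_le (by
    by_contra hcon
    have := hmin n (by omega)
    omega)
  have hl : s l < R := hmin l (Nat.lt_succ_self l)
  have h1 := hD.2 l s hs
  have hs' : Monotone fun i => s (l + 1 + i) := fun i j hij => hs (by omega)
  have h2 := hw.2 m (fun i => s (l + 1 + i)) hs'
  have h3 : incrSum p (_root_.glue R D w) (l + 1 + m) s
      = incrSum p D l s + |w (s (l + 1)) - D (s l)| ^ p
        + incrSum p w m (fun i => s (l + 1 + i)) := by
    rw [← incrSum_congr (p := p) (n := l) (s := s) (t := s) (x := _root_.glue R D w) (y := D)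
        (fun i hi => hlt i ((hs hi).trans_lt hl)),
      ← incrSum_congr (p := p) (n := m) (s := fun i => s (l + 1 + i))
        (t := fun i => s (l + 1 + i)) (x := _root_.glue R D w) (y := w)
        (fun i hi => hge _ (hk.trans (hs (by omega)))), ← hge _ hk, ← hlt _ hl]
    unfold incrSum
    rw [Finset.sum_range_add, Finset.sum_range_succ]
    rfl
  have h4 : |w (s (l + 1)) - D (s l)| ^ p ≤ |2 * w (s (l + 1))| ^ p + |2 * D (s l)| ^ p := by
    have hA := Real.rpow_nonneg (abs_nonneg (2 * w (s (l + 1)))) p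
    have hB := Real.rpow_nonneg (abs_nonneg (2 * D (s l))) p
    have hp0 : 0 ≤ p := by linarith
    rcases le_total |w (s (l + 1))| |D (s l)| with hle | hle
    · have : |w (s (l + 1)) - D (s l)| ≤ |2 * D (s l)| := by
        rw [abs_mul, abs_two]
        linarith [abs_sub (w (s (l + 1))) (D (s l))]
      linarith [Real.rpow_le_rpow (abs_nonneg _) this hp0]
    · have : |w (s (l + 1)) - D (s l)| ≤ |2 * w (s (l + 1))| := by
        rw [abs_mul, abs_two]
        linarith [abs_sub (w (s (l + 1))) (D (s l))]
      linarith [Real.rpow_le_rpow (abs_nonneg _) this hp0]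
  unfold endSum at h1 h2 ⊢
  rw [h3, hlt 0 h0, hge _ h]
  simp only [add_zero] at h2
  linarith

/-- A sequence supported in a finite interval with small entries has small norm. -/
theorem endVarLE_glue_zero {p : ℝ} (hp : 1 ≤ p) {w : ℕ → ℝ} {η : ℝ} (R : ℕ)
    (hw : ∀ i < R, |w i| ≤ η) : EndVarLE p (R * (10 * η)) (glue R w 0) := by
  induction R with
  | zero =>
    have h : glue 0 w 0 = (0 : ℝ) • stepSeq 0 := by
      funext i
      simp [glue]
    rw [h]
    have := (endVarLE_stepSeq hp 0).smul 0
    simpa using this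
  | succ R ih =>
    have h : glue (R + 1) w 0 = glue R w 0 + w R • (Pi.single R 1 : ℕ → ℝ) := by
      funext i
      simp only [glue, Pi.zero_apply, Pi.add_apply, Pi.smul_apply, Pi.single_apply, smul_eq_mul]
      rcases lt_trichotomy i R with hi | hi | hi
      · rw [if_pos (by omega), if_pos hi, if_neg hi.ne]; ring
      · subst hi; simp
      · rw [if_neg (by omega), if_neg (by omega), if_neg hi.ne']; ring
    rw [h]
    refine ((ih fun i hi => hw i (by omega)).add hp ((endVarLE_single hp R).smul (w R))).mono
      (by linarith) ?_
    push_cast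
    linarith [hw R (Nat.lt_succ_self R)]

/-- If the tail of `D` has small variation and small values then it has small norm. -/
theorem endVarLE_glue_tail {p : ℝ} (hp : 1 ≤ p) {D : ℕ → ℝ} {δ : ℝ} {R : ℕ}
    (hD : VarLE p δ (fun i => D (max i R))) (hR : |D R| ≤ 2 * δ) :
    EndVarLE p (15 * δ) (glue R 0 D) := by
  have hp0 : 0 < p := by linarith
  have h1 : EndVarLE p (δ + 4 * δ) (fun i => D (max i R) - D R) := by
    refine EndVarLE.of_varLE hp (hD.sub_const (D R)) fun i => ?_
    have := hD.abs_sub_le hp0 0 i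
    simpa using this
  have h2 : glue R 0 D = (fun i => D (max i R) - D R) + D R • stepSeq R := by
    funext i
    simp only [glue, Pi.zero_apply, Pi.add_apply, Pi.smul_apply, stepSeq, smul_eq_mul]
    rcases lt_or_ge i R with hi | hi
    · rw [if_pos hi, if_neg (by omega), max_eq_right hi.le]; ring
    · rw [if_neg (by omega), if_pos hi, max_eq_left hi]; ring
  rw [h2]
  refine (h1.add hp ((endVarLE_stepSeq hp R).smul (D R))).mono hp0.le ?_
  linarith

theorem EndVarLE.add_of_small {p a b δ η : ℝ} (hp : 1 ≤ p) {D w : ℕ → ℝ} {R : ℕ}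
    (hD : EndVarLE p a D) (hw : EndVarLE p b w) (hRη : R * (10 * η) ≤ δ)
    (htail : VarLE p δ (fun i => D (max i R))) (hR : |D R| ≤ 2 * δ) (hwη : ∀ i < R, |w i| ≤ η) :
    EndVarLE p ((a ^ p + b ^ p) ^ (1 / p) + 16 * δ) (D + w) := by
  have hp0 : 0 < p := by linarith
  have ha := hD.1
  have hb := hw.1
  have h1 : EndVarLE p ((a ^ p + b ^ p) ^ (1 / p)) (_root_.glue R D w) := by
    refine hD.glue hp hw (by positivity) (le_of_eq ?_) R
    rw [← Real.rpow_mul (by positivity), one_div_mul_cancel hp0.ne', Real.rpow_one]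
  have h2 : D + w = _root_.glue R D w + (_root_.glue R w 0 + _root_.glue R 0 D) := by
    funext i
    simp only [_root_.glue, Pi.add_apply, Pi.zero_apply]
    split_ifs <;> ring
  rw [h2]
  refine (h1.add hp ((endVarLE_glue_zero hp R hwη).add hp
    (endVarLE_glue_tail hp htail hR))).mono hp0.le ?_
  linarith

namespace JamesSpace

variable {p : ℝ} [hp : Fact (1 < p)]

theorem endVarLE (x : JamesSpace p) : EndVarLE p (‖x‖ + 4 * ‖x‖) x.toSeq :=
  EndVarLE.of_varLE (one_lt p).le x.varLE x.abs_apply_le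

theorem endVarLE_sInf (x : JamesSpace p) : EndVarLE p (sInf {a | EndVarLE p a x.toSeq}) x.toSeq := by
  have hpp := exp_pos p
  have hne : {a | EndVarLE p a x.toSeq}.Nonempty := ⟨_, x.endVarLE⟩
  have h0 : 0 ≤ sInf {a | EndVarLE p a x.toSeq} := le_csInf hne fun a ha => ha.1
  refine ⟨h0, fun n s hs => ?_⟩
  have h1 : endSum p x.toSeq n s ^ (1 / p) ≤ sInf {a | EndVarLE p a x.toSeq} := by
    refine le_csInf hne fun a ha => ?_
    have := Real.rpow_le_rpow (endSum_nonneg _ _ _ _) (ha.2 n s hs) (by positivity : 0 ≤ 1 / p)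
    rwa [← Real.rpow_mul ha.1, mul_one_div_cancel hpp.ne', Real.rpow_one] at this
  have h2 := Real.rpow_le_rpow (Real.rpow_nonneg (endSum_nonneg _ _ _ _) _) h1 hpp.le
  rwa [← Real.rpow_mul (endSum_nonneg _ _ _ _), one_div_mul_cancel hpp.ne', Real.rpow_one] at h2

theorem bddBelow_endVarLE (x : JamesSpace p) : BddBelow {a | EndVarLE p a x.toSeq} :=
  ⟨0, fun _ ha => ha.1⟩

/-- An equivalent norm on `J_p` that is asymptotically uniformly smooth of power type `p`. -/
def smoothNorm (p : ℝ) [hp : Fact (1 < p)] : Seminorm ℝ (JamesSpace p) :=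
  Seminorm.ofSMulLE (fun x => sInf {a | EndVarLE p a x.toSeq})
    (le_antisymm (csInf_le (bddBelow_endVarLE 0) (by
      have := endVarLE (0 : JamesSpace p)
      simpa using this)) (endVarLE_sInf 0).1)
    (fun x y => csInf_le (bddBelow_endVarLE _)
      ((endVarLE_sInf x).add (one_lt p).le (endVarLE_sInf y)))
    (fun c x => csInf_le (bddBelow_endVarLE _) ((endVarLE_sInf x).smul c))

theorem smoothNorm_le_iff {x : JamesSpace p} {a : ℝ} :
    smoothNorm p x ≤ a ↔ EndVarLE p a x.toSeq :=
  ⟨fun h => (endVarLE_sInf x).mono (exp_pos p).le h, fun h => csInf_le (bddBelow_endVarLE _) h⟩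

theorem norm_le_smoothNorm (x : JamesSpace p) : ‖x‖ ≤ smoothNorm p x :=
  norm_le_iff.2 (smoothNorm_le_iff.1 le_rfl).varLE

theorem smoothNorm_basisVec_le (i : ℕ) : smoothNorm p (basisVec i : JamesSpace p) ≤ 10 :=
  smoothNorm_le_iff.2 (endVarLE_single (one_lt p).le i)

/-- Asymptotic uniform smoothness of `smoothNorm`. -/
theorem smoothNorm_add_le (x : JamesSpace p) {δ : ℝ} (hδ : 0 < δ) :
    ∃ N₀ : ℕ, ∀ v : JamesSpace p, (∀ i < N₀, v.toSeq i = 0) →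
      smoothNorm p (x + v) ≤ (smoothNorm p x ^ p + smoothNorm p v ^ p) ^ (1 / p) + δ := by
  have hδ' : 0 < δ / 16 := by positivity
  obtain ⟨R, hR⟩ := x.varLE.exists_tail hδ'
  refine ⟨R, fun v hv => smoothNorm_le_iff.2 ?_⟩
  have h1 : |x.toSeq R| ≤ δ / 16 := by
    have := hR.abs_le_of_tendsto (exp_pos p) (x.tendsto_toSeq.comp (tendsto_max_atTop R)) R
    simpa using this
  have := EndVarLE.add_of_small (δ := δ / 16) (η := 0) (one_lt p).le
    (smoothNorm_le_iff.1 (le_refl (smoothNorm p x)))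
    (smoothNorm_le_iff.1 (le_refl (smoothNorm p v))) (by simpa using hδ'.le) hR
    (by linarith) (fun i hi => by simp [hv i hi])
  refine this.mono (exp_pos p).le (by linarith)

theorem smoothNorm_basisVec_add_rpow_le (n : ℕ) (y : JamesSpace p)
    (hy : ∀ i < n + 1, y.toSeq i = 0) (c : ℝ) :
    smoothNorm p (c • basisVec n + y) ^ p ≤ (10 * |c|) ^ p + smoothNorm p y ^ p := by
  have hpp := exp_pos p
  set b := 10 * |c| with hb
  have hb0 : 0 ≤ b := by positivity
  have h1 : EndVarLE p b (c • basisVec n : JamesSpace p).toSeq := by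
    refine smoothNorm_le_iff.1 ?_
    rw [map_smul_eq_mul, Real.norm_eq_abs, hb, mul_comm]
    exact mul_le_mul_of_nonneg_right (smoothNorm_basisVec_le n) (abs_nonneg c)
  have hN : 0 ≤ smoothNorm p y := apply_nonneg _ _
  have h2 := h1.glue (one_lt p).le (smoothNorm_le_iff.1 (le_refl (smoothNorm p y)))
    (c := (b ^ p + smoothNorm p y ^ p) ^ (1 / p)) (by positivity)
    (by rw [← Real.rpow_mul (by positivity), one_div_mul_cancel hpp.ne', Real.rpow_one]) (n + 1)
  have h3 : glue (n + 1) (c • basisVec n : JamesSpace p).toSeq y.toSeq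
      = (c • basisVec n + y : JamesSpace p).toSeq := by
    funext i
    simp only [glue, toSeq_add, toSeq_smul, toSeq_basisVec, Pi.add_apply, Pi.smul_apply,
      Pi.single_apply]
    split_ifs with h h' h'
    · rw [hy i h, add_zero]
    · rw [hy i h, add_zero]
    · omega
    · simp
  rw [h3] at h2
  have h4 := Real.rpow_le_rpow (apply_nonneg _ _) (smoothNorm_le_iff.2 h2) hpp.le
  rwa [← Real.rpow_mul (by positivity), one_div_mul_cancel hpp.ne', Real.rpow_one] at h4

end JamesSpace

/-! ### Iterated limits along an ultrafilter -/

/-- The limit of a bounded real sequence along a fixed nonprincipal ultrafilter. -/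
def ulim (h : ℕ → ℝ) : ℝ := limUnder (hyperfilter ℕ : Filter ℕ) h

theorem tendsto_ulim {h : ℕ → ℝ} {K : ℝ} (hK : ∀ n, |h n| ≤ K) :
    Tendsto h (hyperfilter ℕ) (𝓝 (ulim h)) := by
  refine tendsto_nhds_limUnder ?_
  obtain ⟨x, -, hx⟩ := (isCompact_Icc (a := -K) (b := K)).ultrafilter_le_nhds
    ((hyperfilter ℕ).map h) (by
      rw [le_principal_iff, Ultrafilter.mem_coe, Ultrafilter.mem_map]
      exact Filter.univ_mem' fun n => abs_le.1 (hK n))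
  exact ⟨x, hx⟩

theorem abs_ulim_le {h : ℕ → ℝ} {K : ℝ} (hK : ∀ n, |h n| ≤ K) : |ulim h| ≤ K :=
  le_of_tendsto' (tendsto_ulim hK).abs hK

theorem eventually_abs_sub_ulim_le {h : ℕ → ℝ} {K ε : ℝ} (hK : ∀ n, |h n| ≤ K) (hε : 0 < ε) :
    ∀ᶠ n in (hyperfilter ℕ : Filter ℕ), |h n - ulim h| ≤ ε := by
  filter_upwards [Metric.tendsto_nhds.1 (tendsto_ulim hK) ε hε] with n hn
  rw [Real.dist_eq] at hn
  exact hn.le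

theorem eventually_ge_hyperfilter (b : ℕ) : ∀ᶠ n in (hyperfilter ℕ : Filter ℕ), b ≤ n := by
  have h : (hyperfilter ℕ : Filter ℕ) ≤ atTop := Nat.cofinite_eq_atTop ▸ hyperfilter_le_cofinite
  exact h (eventually_ge_atTop b)

/-- The iterated ultrafilter limit of a function of `k` natural numbers. -/
def iterLim : ℕ → (List ℕ → ℝ) → ℝ
  | 0, h => h []
  | k + 1, h => ulim fun n => iterLim k fun l => h (n :: l)

/-- The property `P` holds for almost all lists of length `k`, in the iterated sense. -/
def Generic : ℕ → (List ℕ → Prop) → Prop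
  | 0, P => P []
  | k + 1, P => ∀ᶠ n in (hyperfilter ℕ : Filter ℕ), Generic k fun l => P (n :: l)

theorem Generic.mono {k : ℕ} {P Q : List ℕ → Prop} (h : Generic k P) (hPQ : ∀ l, P l → Q l) :
    Generic k Q := by
  induction k generalizing P Q with
  | zero => exact hPQ _ h
  | succ k ih => exact Eventually.mono h fun n hn => ih hn fun l => hPQ _

theorem generic_all {ι : Type*} [Finite ι] {k : ℕ} {P : ι → List ℕ → Prop}
    (h : ∀ i, Generic k (P i)) : Generic k fun l => ∀ i, P i l := by
  induction k generalizing P with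
  | zero => exact h
  | succ k ih => exact (eventually_all.2 h).mono fun n hn => ih hn

theorem abs_iterLim_le {k : ℕ} {h : List ℕ → ℝ} {K : ℝ} (hK : ∀ l, l.length = k → |h l| ≤ K) :
    |iterLim k h| ≤ K := by
  induction k generalizing h with
  | zero => exact hK _ rfl
  | succ k ih => exact abs_ulim_le fun n => ih fun l hl => hK _ (by simp [hl])

theorem generic_abs_sub_iterLim_le {k : ℕ} {h : List ℕ → ℝ} {K ε : ℝ}
    (hK : ∀ l, l.length = k → |h l| ≤ K) (hε : 0 < ε) :
    Generic k fun l => |h l - iterLim k h| ≤ ε := by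
  induction k generalizing h ε with
  | zero => simpa [Generic, iterLim] using hε.le
  | succ k ih =>
    have hK' : ∀ n, ∀ l : List ℕ, l.length = k → |h (n :: l)| ≤ K :=
      fun n l hl => hK _ (by simp [hl])
    have h1 := eventually_abs_sub_ulim_le (h := fun n => iterLim k fun l => h (n :: l))
      (fun n => abs_iterLim_le (hK' n)) (half_pos hε)
    filter_upwards [h1] with n hn
    refine (ih (hK' n) (half_pos hε)).mono fun l hl => ?_
    have h2 := abs_sub_le (h (n :: l)) (iterLim k fun l => h (n :: l)) (iterLim (k + 1) h)
    simp only [iterLim] at h2 hn ⊢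
    linarith

/-- The pointwise iterated limit of a function of `k` natural numbers with values in sequences. -/
def seqLim (k : ℕ) (f : List ℕ → ℕ → ℝ) : ℕ → ℝ := fun t => iterLim k fun l => f l t

/-- For each `k`, the function `f` is uniformly bounded on lists of length `k`. -/
def BddOnLists (f : List ℕ → ℕ → ℝ) : Prop :=
  ∀ k, ∃ K, ∀ l : List ℕ, l.length = k → ∀ t, |f l t| ≤ K

theorem BddOnLists.cons {f : List ℕ → ℕ → ℝ} (hf : BddOnLists f) (n : ℕ) :
    BddOnLists fun l => f (n :: l) := fun k =>
  (hf (k + 1)).imp fun _ hK _ hl => hK _ (by simp [hl])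

theorem abs_seqLim_le {k : ℕ} {f : List ℕ → ℕ → ℝ} {K : ℝ}
    (hK : ∀ l : List ℕ, l.length = k → ∀ t, |f l t| ≤ K) (t : ℕ) : |seqLim k f t| ≤ K :=
  abs_iterLim_le fun l hl => hK l hl t

theorem abs_seqLim_cons_le {k : ℕ} {f : List ℕ → ℕ → ℝ} {K : ℝ}
    (hK : ∀ l : List ℕ, l.length = k + 1 → ∀ t, |f l t| ≤ K) (n t : ℕ) :
    |seqLim k (fun l => f (n :: l)) t| ≤ K :=
  abs_seqLim_le (f := fun l => f (n :: l)) (fun l hl => hK _ (by simp [hl])) t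

theorem tendsto_seqLim_cons {f : List ℕ → ℕ → ℝ} (hf : BddOnLists f) (k t : ℕ) :
    Tendsto (fun n => seqLim k (fun l => f (n :: l)) t) (hyperfilter ℕ)
      (𝓝 (seqLim (k + 1) f t)) := by
  obtain ⟨K, hK⟩ := hf (k + 1)
  exact tendsto_ulim (h := fun n => seqLim k (fun l => f (n :: l)) t) (K := K)
    fun n => abs_seqLim_cons_le hK n t

theorem EndVarLE.of_tendsto {p a : ℝ} (hp : 0 ≤ p) (ha : 0 ≤ a) {x : ℕ → ℕ → ℝ} {y : ℕ → ℝ}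
    (hx : ∀ n, EndVarLE p a (x n))
    (hxy : ∀ t, Tendsto (fun n => x n t) (hyperfilter ℕ) (𝓝 (y t))) : EndVarLE p a y := by
  refine ⟨ha, fun n s hs => ?_⟩
  have h : Tendsto (fun k => endSum p (x k) n s) (hyperfilter ℕ) (𝓝 (endSum p y n s)) := by
    unfold endSum incrSum
    refine ((tendsto_finsetSum _ fun i _ => ?_).add ?_).add ?_
    · exact ((hxy _).sub (hxy _)).abs.rpow_const (Or.inr hp)
    · exact ((hxy _).const_mul 2).abs.rpow_const (Or.inr hp)
    · exact ((hxy _).const_mul 2).abs.rpow_const (Or.inr hp)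
  exact le_of_tendsto' h fun k => (hx k).2 n s hs

theorem endVarLE_seqLim_sub {p a : ℝ} (hp : 0 ≤ p) (ha : 0 ≤ a) {k : ℕ} {f g : List ℕ → ℕ → ℝ}
    (hf : BddOnLists f) (hg : BddOnLists g)
    (h : ∀ l : List ℕ, l.length = k → EndVarLE p a (f l - g l)) :
    EndVarLE p a (seqLim k f - seqLim k g) := by
  induction k generalizing f g with
  | zero => exact h [] rfl
  | succ k ih =>
    refine EndVarLE.of_tendsto hp ha (fun n => ih (hf.cons n) (hg.cons n)
      fun l hl => h (n :: l) (by simp [hl])) fun t => ?_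
    exact (tendsto_seqLim_cons hf k t).sub (tendsto_seqLim_cons hg k t)

/-- Changing one entry of the list changes `f` by at most `L`. -/
def HammingLip (p L : ℝ) (f : List ℕ → ℕ → ℝ) : Prop :=
  ∀ (l₁ : List ℕ) (m n : ℕ) (l₂ : List ℕ), EndVarLE p L (f (l₁ ++ m :: l₂) - f (l₁ ++ n :: l₂))

theorem HammingLip.cons {p L : ℝ} {f : List ℕ → ℕ → ℝ} (hf : HammingLip p L f) (n : ℕ) :
    HammingLip p L fun l => f (n :: l) := fun l₁ m m' l₂ => hf (n :: l₁) m m' l₂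

theorem HammingLip.seqLim_cons_sub {p L : ℝ} (hp : 0 ≤ p) {f : List ℕ → ℕ → ℝ}
    (hL : HammingLip p L f) (hf : BddOnLists f) (k n : ℕ) :
    EndVarLE p L (seqLim k (fun l => f (n :: l)) - seqLim (k + 1) f) := by
  have hL0 : 0 ≤ L := (hL [] 0 0 []).1
  refine EndVarLE.of_tendsto hp hL0 (fun m => endVarLE_seqLim_sub (k := k) hp hL0 (hf.cons n)
    (hf.cons m) fun l _ => hL [] n m l) fun t => ?_
  exact tendsto_const_nhds.sub (tendsto_seqLim_cons hf k t)

/-- The limits at infinity of the partial iterated limits of `f` are generically close to given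
constants. -/
def LimitsNear (ε : ℝ) : ℕ → (List ℕ → ℕ → ℝ) → (ℕ → ℝ) → Prop
  | 0, f, c => |ulim (f []) - c 0| ≤ ε
  | k + 1, f, c => |ulim (seqLim (k + 1) f) - c (k + 1)| ≤ ε ∧
      ∀ᶠ n in (hyperfilter ℕ : Filter ℕ), LimitsNear ε k (fun l => f (n :: l)) c

theorem LimitsNear.abs_sub_le {ε : ℝ} {k : ℕ} {f : List ℕ → ℕ → ℝ} {c : ℕ → ℝ}
    (h : LimitsNear ε k f c) : |ulim (seqLim k f) - c k| ≤ ε := by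
  cases k with
  | zero => exact h
  | succ k => exact h.1

theorem LimitsNear.congr {ε ε' : ℝ} {k : ℕ} {f : List ℕ → ℕ → ℝ} {c c' : ℕ → ℝ}
    (h : LimitsNear ε k f c) (hc : ∀ j ≤ k, |c j - c' j| ≤ ε') : LimitsNear (ε + ε') k f c' := by
  induction k generalizing f with
  | zero =>
    have h1 := hc 0 le_rfl
    have h2 := _root_.abs_sub_le (ulim (f [])) (c 0) (c' 0)
    simp only [LimitsNear] at h ⊢
    linarith
  | succ k ih =>
    refine ⟨?_, h.2.mono fun n hn => ih hn fun j hj => hc j (by omega)⟩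
    have h1 := hc (k + 1) le_rfl
    have h2 := _root_.abs_sub_le (ulim (seqLim (k + 1) f)) (c (k + 1)) (c' (k + 1))
    linarith [h.1]

theorem exists_limitsNear {k : ℕ} {f : List ℕ → ℕ → ℝ} {K ε : ℝ}
    (hK : ∀ l : List ℕ, l.length = k → ∀ t, |f l t| ≤ K) (hε : 0 < ε) :
    ∃ c : ℕ → ℝ, (∀ j, |c j| ≤ K) ∧ LimitsNear ε k f c := by
  induction k generalizing f ε with
  | zero =>
    refine ⟨fun _ => ulim (f []), fun _ => abs_ulim_le (hK [] rfl), ?_⟩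
    simpa [LimitsNear] using hε.le
  | succ k ih =>
    have h1 : ∀ n : ℕ, ∃ c : ℕ → ℝ, (∀ j, |c j| ≤ K) ∧
        LimitsNear (ε / 2) k (fun l => f (n :: l)) c :=
      fun n => ih (fun l hl => hK _ (by simp [hl])) (half_pos hε)
    choose c hcK hc using h1
    refine ⟨fun j => if j = k + 1 then ulim (seqLim (k + 1) f) else ulim fun n => c n j, ?_, ?_, ?_⟩
    · intro j
      dsimp only
      split_ifs
      · exact abs_ulim_le (abs_seqLim_le hK)
      · exact abs_ulim_le fun n => hcK n j
    · simpa using hε.le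
    · have h2 : ∀ᶠ n in (hyperfilter ℕ : Filter ℕ), ∀ j ∈ Finset.range (k + 1),
          |c n j - ulim fun n => c n j| ≤ ε / 2 :=
        (eventually_all_finset _).2 fun j _ =>
          eventually_abs_sub_ulim_le (fun n => hcK n j) (half_pos hε)
      filter_upwards [h2] with n hn
      have h3 := (hc n).congr (ε' := ε / 2)
        (c' := fun j => if j = k + 1 then ulim (seqLim (k + 1) f) else ulim fun n => c n j)
        fun j hj => by
          rw [if_neg (by omega)]
          exact hn j (Finset.mem_range.2 (by omega))
      rwa [add_halves] at h3

/-! ### The interlacing estimate -/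

/-- The lists `l` and `m` of equal length are strictly interlaced, with entries at least `b`. -/
inductive Interlaced : ℕ → List ℕ → List ℕ → Prop
  | nil (b : ℕ) : Interlaced b [] []
  | cons {b m n : ℕ} {l l' : List ℕ} (hb : b ≤ n) (hnm : n < m) (h : Interlaced (m + 1) l l') :
      Interlaced b (n :: l) (m :: l')

theorem rpow_one_div_add_le {p x d Y : ℝ} (hp : 1 ≤ p) (hx : 0 ≤ x) (hd : 0 ≤ d) (hY : 0 ≤ Y) :
    ((x + d) ^ p + Y) ^ (1 / p) ≤ (x ^ p + Y) ^ (1 / p) + d := by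
  have hp0 : 0 < p := by linarith
  have h := Real.Lp_add_le_of_nonneg (f := ![x, Y ^ (1 / p)]) (g := ![d, 0])
    Finset.univ hp (fun i _ => by fin_cases i <;> simp <;> positivity)
    (fun i _ => by fin_cases i <;> simp [hd])
  simp only [Fin.sum_univ_two, Matrix.cons_val_zero, Matrix.cons_val_one, add_zero,
    Real.zero_rpow hp0.ne'] at h
  rwa [← Real.rpow_mul hY, one_div_mul_cancel hp0.ne', Real.rpow_one, ← Real.rpow_mul hd,
    mul_one_div_cancel hp0.ne', Real.rpow_one] at h

theorem exists_interlaced_aux {ι : Type*} [Finite ι] {p L : ι → ℝ} (hp : ∀ i, 1 ≤ p i) {δ : ℝ}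
    (hδ : 0 < δ) (k : ℕ) : ∀ (f g : ι → List ℕ → ℕ → ℝ) (c : ι → ℕ → ℝ) (P Q : List ℕ → Prop)
    (b : ℕ) (a : ι → ℝ), (∀ i, BddOnLists (f i)) → (∀ i, BddOnLists (g i)) →
    (∀ i, HammingLip (p i) (L i) (f i)) → (∀ i, HammingLip (p i) (L i) (g i)) →
    (∀ i, LimitsNear (δ / 2) k (f i) (c i)) → (∀ i, LimitsNear (δ / 2) k (g i) (c i)) →
    (∀ i, EndVarLE (p i) (a i) (seqLim k (f i) - seqLim k (g i))) →
    Generic k P → Generic k Q →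
    ∃ l m : List ℕ, Interlaced b l m ∧ l.length = k ∧ m.length = k ∧ P l ∧ Q m ∧
      ∀ i, EndVarLE (p i) ((a i ^ p i + k * (2 * L i) ^ p i) ^ (1 / p i) + k * (16 * δ))
        (f i l - g i m) := by
  induction k with
  | zero =>
    intro f g c P Q b a _ _ _ _ _ _ hD hP hQ
    refine ⟨[], [], .nil b, rfl, rfl, hP, hQ, fun i => ?_⟩
    have hpi : p i ≠ 0 := by linarith [hp i]
    have h := hD i
    simp only [CharP.cast_eq_zero, zero_mul, add_zero]
    rw [← Real.rpow_mul h.1, mul_one_div_cancel hpi, Real.rpow_one]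
    exact h
  | succ k ih =>
    intro f g c P Q b a hf hg hLf hLg hcf hcg hD hP hQ
    have hR : ∀ i, ∃ (R : ℕ) (η : ℝ), 0 < η ∧ R * (10 * η) ≤ δ ∧
        VarLE (p i) δ (fun j => (seqLim (k + 1) (f i) - seqLim (k + 1) (g i)) (max j R)) ∧
        |(seqLim (k + 1) (f i) - seqLim (k + 1) (g i)) R| ≤ 2 * δ := by
      intro i
      have hp0 : 0 < p i := by linarith [hp i]
      obtain ⟨R, hR⟩ := (hD i).varLE.exists_tail hδ
      refine ⟨R, δ / (10 * (R + 1)), by positivity, ?_, hR, ?_⟩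
      · have : (R : ℝ) * (10 * (δ / (10 * (R + 1)))) = δ * (R / (R + 1)) := by
          field_simp
        rw [this]
        refine mul_le_of_le_one_right hδ.le ((div_le_one (by positivity)).2 (by linarith))
      · obtain ⟨K, hK⟩ := hf i (k + 1)
        obtain ⟨K', hK'⟩ := hg i (k + 1)
        have h1 := (tendsto_ulim (abs_seqLim_le hK)).sub (tendsto_ulim (abs_seqLim_le hK'))
        have h2 := (h1.sub_const ((seqLim (k + 1) (f i) - seqLim (k + 1) (g i)) R)).abs
        have h3 := le_of_tendsto h2 ((eventually_ge_hyperfilter R).mono fun t ht => by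
          have h4 := hR.abs_sub_le hp0 R t
          simp only [max_self, max_eq_left ht] at h4
          exact h4)
        have h5 := abs_le.1 (hcf i).abs_sub_le
        have h6 := abs_le.1 (hcg i).abs_sub_le
        have h7 := abs_le.1 h3
        refine abs_le.2 ⟨?_, ?_⟩ <;> linarith [h5.1, h5.2, h6.1, h6.2, h7.1, h7.2]
    choose R η hη hRη htail hDR using hR
    have hnear : ∀ (F : ι → List ℕ → ℕ → ℝ), (∀ i, BddOnLists (F i)) →
        ∀ᶠ n in (hyperfilter ℕ : Filter ℕ), ∀ i, ∀ t ∈ Finset.range (R i),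
          |seqLim k (fun l => F i (n :: l)) t - seqLim (k + 1) (F i) t| ≤ η i / 2 := by
      intro F hF
      refine eventually_all.2 fun i => (eventually_all_finset _).2 fun t _ => ?_
      obtain ⟨K, hK⟩ := hF i (k + 1)
      exact eventually_abs_sub_ulim_le (h := fun n => seqLim k (fun l => F i (n :: l)) t)
        (fun n => abs_seqLim_cons_le hK n t) (half_pos (hη i))
    obtain ⟨n, hn1, hn2, hn3, hn4⟩ := ((hnear f hf).and ((eventually_all.2 fun i => (hcf i).2).and
      (Eventually.and hP (eventually_ge_hyperfilter b)))).exists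
    obtain ⟨m, hm1, hm2, hm3, hm4⟩ := ((hnear g hg).and ((eventually_all.2 fun i => (hcg i).2).and
      (Eventually.and hQ (eventually_ge_hyperfilter (n + 1))))).exists
    obtain ⟨l, l', hll, hl, hl', hPl, hQl, hfin⟩ := ih (fun i l => f i (n :: l))
      (fun i l => g i (m :: l)) c (fun l => P (n :: l)) (fun l => Q (m :: l)) (m + 1)
      (fun i => (a i ^ p i + (2 * L i) ^ p i) ^ (1 / p i) + 16 * δ)
      (fun i => (hf i).cons n) (fun i => (hg i).cons m) (fun i => (hLf i).cons n)
      (fun i => (hLg i).cons m) hn2 hm2 (by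
        intro i
        have hp0 : 0 ≤ p i := by linarith [hp i]
        have hw := ((hLf i).seqLim_cons_sub hp0 (hf i) k n).sub (hp i)
          ((hLg i).seqLim_cons_sub hp0 (hg i) k m)
        rw [← two_mul] at hw
        have h1 := (hD i).add_of_small (hp i) hw (hRη i) (htail i) (hDR i) (by
          intro t ht
          have h2 := abs_le.1 (hn1 i t (Finset.mem_range.2 ht))
          have h3 := abs_le.1 (hm1 i t (Finset.mem_range.2 ht))
          simp only [Pi.sub_apply]
          exact abs_le.2 ⟨by linarith [h2.1, h3.2], by linarith [h2.2, h3.1]⟩)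
        convert h1 using 1
        abel) hn3 hm3
    refine ⟨n :: l, m :: l', .cons hn4 hm4 hll, by simp [hl], by simp [hl'], hPl, hQl, fun i => ?_⟩
    have hp0 : 0 < p i := by linarith [hp i]
    refine (hfin i).mono hp0.le ?_
    have hL : 0 ≤ L i := ((hLf i) [] 0 0 []).1
    have ha := (hD i).1
    have h1 := rpow_one_div_add_le (x := (a i ^ p i + (2 * L i) ^ p i) ^ (1 / p i)) (d := 16 * δ)
      (Y := k * (2 * L i) ^ p i) (hp i) (by positivity) (by positivity) (by positivity)
    rw [← Real.rpow_mul (by positivity) (1 / p i) (p i), one_div_mul_cancel hp0.ne',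
      Real.rpow_one] at h1
    have h2 : a i ^ p i + ((k + 1 : ℕ) : ℝ) * (2 * L i) ^ p i
        = a i ^ p i + (2 * L i) ^ p i + k * (2 * L i) ^ p i := by
      push_cast
      ring
    rw [h2]
    push_cast
    linarith

/-- Families of sequences that are Lipschitz for the Hamming distance are concentrated along
interlaced pairs of generic lists. -/
theorem exists_interlaced {ι : Type*} [Finite ι] {p L : ι → ℝ} (hp : ∀ i, 1 ≤ p i) {δ : ℝ}
    (hδ : 0 < δ) (k b : ℕ) (f : ι → List ℕ → ℕ → ℝ) (P : List ℕ → Prop)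
    (hf : ∀ i, BddOnLists (f i)) (hL : ∀ i, HammingLip (p i) (L i) (f i)) (hP : Generic k P) :
    ∃ l m : List ℕ, Interlaced b l m ∧ l.length = k ∧ m.length = k ∧ P l ∧ P m ∧
      ∀ i, EndVarLE (p i) ((k : ℝ) ^ (1 / p i) * (2 * L i) + δ) (f i l - f i m) := by
  have hδ' : 0 < δ / (16 * (k + 1)) := by positivity
  have hc : ∀ i, ∃ c : ℕ → ℝ, LimitsNear (δ / (16 * (k + 1)) / 2) k (f i) c := fun i => by
    obtain ⟨K, hK⟩ := hf i k
    obtain ⟨c, -, hc⟩ := exists_limitsNear hK (half_pos hδ')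
    exact ⟨c, hc⟩
  choose c hc using hc
  obtain ⟨l, m, hlm, hl, hm, hPl, hPm, h⟩ := exists_interlaced_aux hp hδ' k f f c P P b
    (fun _ => 0) hf hf hL hL hc hc (fun i => by
      rw [sub_self]
      have := (endVarLE_stepSeq (hp i) 0).smul 0
      simpa using this) hP hP
  refine ⟨l, m, hlm, hl, hm, hPl, hPm, fun i => ?_⟩
  have hp0 : 0 < p i := by linarith [hp i]
  have hL0 : 0 ≤ L i := ((hL i) [] 0 0 []).1
  refine (h i).mono hp0.le ?_
  rw [Real.zero_rpow hp0.ne', zero_add, Real.mul_rpow (by positivity) (by positivity),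
    ← Real.rpow_mul (by positivity) (p i), mul_one_div_cancel hp0.ne', Real.rpow_one]
  have h1 : (k : ℝ) * (16 * (δ / (16 * (k + 1)))) = δ * (k / (k + 1)) := by
    field_simp
  rw [h1]
  have h2 : δ * ((k : ℝ) / (k + 1)) ≤ δ :=
    mul_le_of_le_one_right hδ.le ((div_le_one (by positivity)).2 (by linarith))
  linarith

/-! ### Approximate midpoints -/

theorem exists_midpoint_params {s r L ε : ℝ} (hs : 1 ≤ s) (hsr : s < r) (hL : 0 ≤ L) (hε : 0 < ε) :
    ∃ δ η : ℝ, 0 < δ ∧ δ < 1 ∧ 0 < η ∧ η ≤ ε * δ ^ (1 / r) ∧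
      ((L + η) * (1 + δ)) ^ s ≤ max (L - 2 * η) 0 ^ s + (ε * δ ^ (1 / r)) ^ s := by
  have hs0 : 0 < s := by linarith
  have hr0 : 0 < r := by linarith
  have he : 0 < 1 - s / r := by
    rw [sub_pos, div_lt_one hr0]
    exact hsr
  have h1 : Tendsto (fun δ : ℝ => δ ^ (1 - s / r) * (L ^ s * 2 ^ s)) (𝓝[>] 0) (𝓝 0) := by
    have h := (Real.continuousAt_rpow_const 0 (1 - s / r) (Or.inr he.le)).tendsto
    rw [Real.zero_rpow he.ne'] at h
    have h' := (h.mul_const (L ^ s * 2 ^ s)).mono_left (nhdsWithin_le_nhds (s := Set.Ioi 0))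
    rwa [zero_mul] at h'
  have h2 : ∀ᶠ δ in 𝓝[>] (0 : ℝ), δ ^ (1 - s / r) * (L ^ s * 2 ^ s) < ε ^ s :=
    h1.eventually_lt_const (by positivity)
  have h3 : ∀ᶠ δ in 𝓝[>] (0 : ℝ), δ ∈ Set.Ioo (0 : ℝ) 1 := Ioo_mem_nhdsGT one_pos
  obtain ⟨δ, hδ, hδ0, hδ1⟩ := (h2.and h3).exists
  have hconv : (1 + δ) ^ s ≤ 1 + δ * 2 ^ s := by
    have h := (convexOn_rpow hs).2 (x := 1) (y := 2) (by simp) (by simp)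
      (by linarith : 0 ≤ 1 - δ) hδ0.le (by ring)
    simp only [smul_eq_mul, Real.one_rpow, mul_one] at h
    have h' : 1 - δ + δ * 2 = 1 + δ := by ring
    rw [h'] at h
    linarith
  have hmain : (L * (1 + δ)) ^ s < L ^ s + (ε * δ ^ (1 / r)) ^ s := by
    rw [Real.mul_rpow hL (by linarith), Real.mul_rpow hε.le (by positivity),
      ← Real.rpow_mul hδ0.le, one_div_mul_eq_div]
    have h4 : δ * (L ^ s * 2 ^ s) < ε ^ s * δ ^ (s / r) := by
      have h5 := mul_lt_mul_of_pos_right hδ (Real.rpow_pos_of_pos hδ0 (s / r))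
      have h6 : δ ^ (1 - s / r) * (L ^ s * 2 ^ s) * δ ^ (s / r) = δ * (L ^ s * 2 ^ s) := by
        rw [mul_right_comm, ← Real.rpow_add hδ0, sub_add_cancel, Real.rpow_one]
      rwa [h6] at h5
    have h7 := mul_le_mul_of_nonneg_left hconv (Real.rpow_nonneg hL s)
    linarith
  have hcont : Continuous fun η : ℝ => ((L + η) * (1 + δ)) ^ s - max (L - 2 * η) 0 ^ s :=
    (Continuous.rpow_const (by fun_prop) fun _ => Or.inr hs0.le).sub
      (Continuous.rpow_const (by fun_prop) fun _ => Or.inr hs0.le)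
  have h8 : ∀ᶠ η in 𝓝[>] (0 : ℝ),
      ((L + η) * (1 + δ)) ^ s - max (L - 2 * η) 0 ^ s < (ε * δ ^ (1 / r)) ^ s := by
    refine (hcont.tendsto 0).mono_left nhdsWithin_le_nhds |>.eventually_lt_const ?_
    simp only [add_zero, mul_zero, sub_zero, max_eq_left hL]
    linarith
  have hpos : 0 < ε * δ ^ (1 / r) := by positivity
  obtain ⟨η, hη, hη0, hη1⟩ := (h8.and (Ioo_mem_nhdsGT hpos)).exists
  exact ⟨δ, η, hδ0, hδ1, hη0, hη1.le, by linarith⟩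

theorem JamesSpace.one_le_smoothNorm_basisVec {r : ℝ} [Fact (1 < r)] (i : ℕ) :
    1 ≤ smoothNorm r (basisVec i : JamesSpace r) := by
  have h1 := (basisVec i : JamesSpace r).abs_apply_le i
  have h2 := norm_le_smoothNorm (basisVec i : JamesSpace r)
  simp only [toSeq_basisVec, Pi.single_eq_same, abs_one] at h1
  linarith

/-- The optimal Lipschitz constant at large distances is almost attained. -/
theorem exists_almost_extremal {r : ℝ} [Fact (1 < r)] {Z : Type*} [AddCommGroup Z] [Module ℝ Z]
    (ν : Seminorm ℝ Z) (g : JamesSpace r → Z) {θ B : ℝ}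
    (hg : ∀ x y, θ ≤ JamesSpace.smoothNorm r (x - y) →
      ν (g x - g y) ≤ B * JamesSpace.smoothNorm r (x - y)) :
    ∃ L : ℝ, 0 ≤ L ∧ ∀ η : ℝ, 0 < η →
      (∃ t, ∀ x y, t ≤ JamesSpace.smoothNorm r (x - y) →
        ν (g x - g y) ≤ (L + η) * JamesSpace.smoothNorm r (x - y)) ∧
      ∀ t, ∃ x y, t ≤ JamesSpace.smoothNorm r (x - y) ∧
        (L - η) * JamesSpace.smoothNorm r (x - y) < ν (g x - g y) := by
  set N := JamesSpace.smoothNorm r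
  set S : Set ℝ := {c | ∃ t, ∀ x y, t ≤ N (x - y) → ν (g x - g y) ≤ c * N (x - y)} with hS
  have hne : S.Nonempty := ⟨B, θ, hg⟩
  have hfar : ∀ t : ℝ, ∃ x : JamesSpace r, t ≤ N x ∧ 0 < N x := by
    intro t
    have h1 := JamesSpace.one_le_smoothNorm_basisVec (r := r) 0
    have h2 : N ((|t| + 1) • JamesSpace.basisVec 0) = (|t| + 1) * N (JamesSpace.basisVec 0) := by
      rw [map_smul_eq_mul, Real.norm_eq_abs, abs_of_pos (by positivity)]
    have h3 : |t| + 1 ≤ (|t| + 1) * N (JamesSpace.basisVec 0) :=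
      le_mul_of_one_le_right (by positivity) h1
    refine ⟨(|t| + 1) • JamesSpace.basisVec 0, ?_, ?_⟩
    · rw [h2]; linarith [le_abs_self t]
    · rw [h2]; linarith [abs_nonneg t]
  have h0 : ∀ c ∈ S, 0 ≤ c := by
    rintro c ⟨t, ht⟩
    obtain ⟨x, hx, hx0⟩ := hfar t
    have h1 := ht x 0 (by rwa [sub_zero])
    rw [sub_zero] at h1
    exact nonneg_of_mul_nonneg_left ((apply_nonneg ν _).trans h1) hx0
  refine ⟨sInf S, le_csInf hne h0, fun η hη => ⟨?_, fun t => ?_⟩⟩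
  · obtain ⟨c, ⟨t, ht⟩, hc⟩ := exists_lt_of_csInf_lt hne (by linarith : sInf S < sInf S + η)
    exact ⟨t, fun x y hxy => (ht x y hxy).trans
      (mul_le_mul_of_nonneg_right hc.le (apply_nonneg _ _))⟩
  · by_contra! hcon
    have := csInf_le ⟨0, h0⟩ (show sInf S - η ∈ S from ⟨t, hcon⟩)
    linarith

/-- A map that is Lipschitz at large distances from `J_r` into a space that is asymptotically
uniformly convex of power type `s < r` is almost of finite rank on suitable large balls. -/
theorem exists_ball_tail_le {r s : ℝ} [Fact (1 < r)] (hs : 1 ≤ s) (hsr : s < r) {Z : Type*}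
    [AddCommGroup Z] [Module ℝ Z] {ν : Seminorm ℝ Z} {Q : ℕ → Z →ₗ[ℝ] Z}
    (hZ : AsymptoticallyConvex s ν Q) (g : JamesSpace r → Z) {θ B : ℝ}
    (hg : ∀ x y, θ ≤ JamesSpace.smoothNorm r (x - y) →
      ν (g x - g y) ≤ B * JamesSpace.smoothNorm r (x - y)) {ε : ℝ} (hε : 0 < ε) (t₀ : ℝ) :
    ∃ (ρ : ℝ) (x₀ : JamesSpace r) (N₀ R : ℕ) (c : Z), t₀ ≤ ρ ∧ 0 < ρ ∧
      ∀ v : JamesSpace r, (∀ i < N₀, v.toSeq i = 0) → JamesSpace.smoothNorm r v ≤ ρ →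
        ν (Q R (g (x₀ + v) - c)) ≤ ε * ρ := by
  obtain ⟨L, hL, hext⟩ := exists_almost_extremal ν g hg
  set N := JamesSpace.smoothNorm r
  have hs0 : 0 < s := by linarith
  have hr1 : 1 < r := by linarith
  have hr0 : 0 < r := by linarith
  obtain ⟨δ, η, hδ0, hδ1, hη0, hη1, hmain⟩ :=
    exists_midpoint_params hs hsr hL (by positivity : 0 < ε / 4)
  obtain ⟨⟨t₁, ht₁⟩, hlow⟩ := hext η hη0
  have hδr : 0 < δ ^ (1 / r) := by positivity
  obtain ⟨x, y, hxy, hlt⟩ := hlow (max (2 * t₁ / (1 - δ)) (max (4 * t₀ / δ ^ (1 / r)) 1))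
  obtain ⟨τ, hτ⟩ : ∃ τ, N (x - y) = 2 * τ := ⟨N (x - y) / 2, by ring⟩
  rw [hτ] at hxy hlt
  have h1 : t₁ ≤ (1 - δ) * τ := by
    have := (le_max_left _ _).trans hxy
    rw [div_le_iff₀ (by linarith)] at this
    linarith
  have h2 : t₀ ≤ δ ^ (1 / r) * τ / 2 := by
    have := ((le_max_left _ _).trans (le_max_right _ _)).trans hxy
    rw [div_le_iff₀ hδr] at this
    linarith
  have hτ0 : 0 < τ := by
    have := ((le_max_right _ _).trans (le_max_right _ _)).trans hxy
    linarith
  set u' : JamesSpace r := (1 / 2 : ℝ) • (x - y) with hu'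
  have hNu' : N u' = τ := by
    rw [hu', map_smul_eq_mul, hτ, Real.norm_eq_abs, abs_of_pos (by norm_num)]
    ring
  set u : Z := (1 / 2 : ℝ) • (g x - g y) with hu
  have hνu : (L - η) * τ < ν u := by
    rw [hu, map_smul_eq_mul, Real.norm_eq_abs, abs_of_pos (by norm_num)]
    linarith
  obtain ⟨R, hR⟩ := ((hZ.tendsto_tail u).eventually_le_const
    (by positivity : 0 < η * τ)).exists
  obtain ⟨N₁, hN₁⟩ := JamesSpace.smoothNorm_add_le u' (by positivity : 0 < δ * τ / 2)
  set ρ := δ ^ (1 / r) * τ / 2 with hρ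
  have hρ0 : 0 < ρ := by positivity
  have hball : (τ ^ r + ρ ^ r) ^ (1 / r) + δ * τ / 2 ≤ (1 + δ) * τ := by
    have h3 : ρ ^ r ≤ (δ / 2) * τ ^ r := by
      rw [hρ, mul_div_right_comm, Real.mul_rpow (by positivity) hτ0.le,
        Real.div_rpow hδr.le zero_le_two, ← Real.rpow_mul hδ0.le, one_div_mul_cancel hr0.ne',
        Real.rpow_one]
      have h4 : (2 : ℝ) ≤ 2 ^ r := by
        conv_lhs => rw [← Real.rpow_one 2]
        exact Real.rpow_le_rpow_of_exponent_le one_le_two hr1.le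
      gcongr
    have h5 : (τ ^ r + ρ ^ r) ^ (1 / r) ≤ (1 + δ / 2) * τ := by
      have h6 : τ ^ r + ρ ^ r ≤ ((1 + δ / 2) * τ) ^ r := by
        rw [Real.mul_rpow (by positivity) hτ0.le]
        have h7 : 1 + δ / 2 ≤ (1 + δ / 2) ^ r := by
          conv_lhs => rw [← Real.rpow_one (1 + δ / 2)]
          exact Real.rpow_le_rpow_of_exponent_le (by linarith) hr1.le
        have h8 := mul_le_mul_of_nonneg_right h7 (Real.rpow_nonneg hτ0.le r)
        linarith
      have h9 := Real.rpow_le_rpow (by positivity) h6 (by positivity : 0 ≤ 1 / r)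
      rwa [← Real.rpow_mul (by positivity), mul_one_div_cancel hr0.ne', Real.rpow_one] at h9
    linarith
  have hnear : ∀ v : JamesSpace r, (∀ i < N₁, v.toSeq i = 0) → N v ≤ ρ →
      N (u' + v) ≤ (1 + δ) * τ := by
    intro v hv hvρ
    refine (hN₁ v hv).trans (le_trans ?_ hball)
    rw [hNu']
    have := apply_nonneg N v
    gcongr
  refine ⟨ρ, (1 / 2 : ℝ) • (x + y), N₁, R, (1 / 2 : ℝ) • (g x + g y), h2, hρ0, fun v hv hvρ => ?_⟩
  set z := (1 / 2 : ℝ) • (x + y) + v with hz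
  have hzy : z - y = u' + v := by rw [hz, hu']; module
  have hxz : x - z = u' + -v := by rw [hz, hu']; module
  have hNzy : N (z - y) ≤ (1 + δ) * τ := hzy ▸ hnear v hv hvρ
  have hNxz : N (x - z) ≤ (1 + δ) * τ := by
    rw [hxz]
    refine hnear (-v) (fun i hi => ?_) (by rwa [map_neg_eq_map])
    rw [JamesSpace.toSeq_neg, Pi.neg_apply, hv i hi, neg_zero]
  have htri : 2 * τ ≤ N (x - z) + N (z - y) := by
    rw [← hτ, ← sub_add_sub_cancel x z y]
    exact map_add_le_add N _ _
  have hg1 : ν (g z - g y) ≤ (L + η) * ((1 + δ) * τ) :=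
    (ht₁ z y (by linarith)).trans (mul_le_mul_of_nonneg_left hNzy (by positivity))
  have hg2 : ν (g x - g z) ≤ (L + η) * ((1 + δ) * τ) :=
    (ht₁ x z (by linarith)).trans (mul_le_mul_of_nonneg_left hNxz (by positivity))
  set w := g z - (1 / 2 : ℝ) • (g x + g y) with hw
  have hwu1 : g z - g y = u + w := by rw [hw, hu]; module
  have hwu2 : g x - g z = u - w := by rw [hw, hu]; module
  rw [hwu1] at hg1
  rw [hwu2] at hg2
  have hP : (L - 2 * η) * τ ≤ ν (u - Q R u) := by
    have h3 : ν u ≤ ν (u - Q R u) + ν (Q R u) := by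
      conv_lhs => rw [← sub_add_cancel u (Q R u)]
      exact map_add_le_add ν _ _
    linarith
  have key : ∀ a : Z, ν a ≤ (L + η) * ((1 + δ) * τ) → (L - 2 * η) * τ ≤ ν (a - Q R a) →
      ν (Q R a) ≤ ε / 4 * δ ^ (1 / r) * τ := by
    intro a ha haP
    rw [← Real.rpow_le_rpow_iff (apply_nonneg _ _) (by positivity) hs0]
    have h3 := hZ.convex R a
    have h4 : ν a ^ s ≤ ((L + η) * (1 + δ)) ^ s * τ ^ s := by
      rw [← Real.mul_rpow (by positivity) hτ0.le, mul_assoc]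
      exact Real.rpow_le_rpow (apply_nonneg _ _) ha hs0.le
    have h5 : max (L - 2 * η) 0 ^ s * τ ^ s ≤ ν (a - Q R a) ^ s := by
      rw [← Real.mul_rpow (le_max_right _ _) hτ0.le]
      refine Real.rpow_le_rpow (mul_nonneg (le_max_right _ _) hτ0.le) ?_ hs0.le
      rcases max_cases (L - 2 * η) 0 with h | h
      · rw [h.1]; exact haP
      · rw [h.1, zero_mul]; exact apply_nonneg _ _
    have h6 := mul_le_mul_of_nonneg_right hmain (Real.rpow_nonneg hτ0.le s)
    rw [add_mul (max (L - 2 * η) 0 ^ s)] at h6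
    rw [Real.mul_rpow (by positivity) hτ0.le]
    linarith
  have hητ : η * τ ≤ ε / 4 * δ ^ (1 / r) * τ := mul_le_mul_of_nonneg_right hη1 hτ0.le
  have hgoal : ε * ρ = ε / 4 * δ ^ (1 / r) * τ + ε / 4 * δ ^ (1 / r) * τ := by
    rw [hρ]; ring
  have hsum : 2 * ν (u - Q R u)
      ≤ ν ((u + w) - Q R (u + w)) + ν ((u - w) - Q R (u - w)) := by
    have h3 : (2 : ℝ) • (u - Q R u)
        = ((u + w) - Q R (u + w)) + ((u - w) - Q R (u - w)) := by
      simp only [map_add, map_sub]; module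
    have h4 := map_add_le_add ν ((u + w) - Q R (u + w)) ((u - w) - Q R (u - w))
    rwa [← h3, map_smul_eq_mul, Real.norm_eq_abs, abs_two] at h4
  rw [hgoal]
  rcases le_or_gt ((L - 2 * η) * τ) (ν ((u + w) - Q R (u + w))) with h | h
  · have h3 := key (u + w) hg1 h
    have h4 : Q R w = Q R (u + w) - Q R u := by rw [map_add (Q R) u w]; abel
    have h5 := map_sub_le_add ν (Q R (u + w)) (Q R u)
    rw [h4]
    linarith
  · have h3 := key (u - w) hg2 (by linarith)
    have h4 : Q R w = Q R u - Q R (u - w) := by rw [map_sub (Q R) u w]; abel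
    have h5 := map_sub_le_add ν (Q R u) (Q R (u - w))
    rw [h4]
    linarith

/-! ### Sums of unit vectors along interlaced lists -/

namespace JamesSpace

variable {r : ℝ} [hr : Fact (1 < r)]

/-- The sum of the unit vectors with indices in a list. -/
def listVec (r : ℝ) [Fact (1 < r)] (l : List ℕ) : JamesSpace r := (l.map basisVec).sum

theorem listVec_nil : listVec r [] = 0 := rfl

theorem listVec_cons (n : ℕ) (l : List ℕ) : listVec r (n :: l) = basisVec n + listVec r l := by
  simp [listVec]

theorem listVec_append_cons_sub (l₁ : List ℕ) (m n : ℕ) (l₂ : List ℕ) :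
    listVec r (l₁ ++ m :: l₂) - listVec r (l₁ ++ n :: l₂) = basisVec m - basisVec n := by
  simp [listVec]

theorem norm_listVec_le (l : List ℕ) : ‖listVec r l‖ ≤ 2 * l.length := by
  induction l with
  | nil => simp [listVec_nil]
  | cons n l ih =>
    rw [listVec_cons]
    refine (norm_add_le _ _).trans ?_
    push_cast [List.length_cons]
    linarith [norm_basisVec_le (p := r) n]

theorem toSeq_basisVec_of_ne {i n : ℕ} (h : i ≠ n) : (basisVec n : JamesSpace r).toSeq i = 0 := by
  rw [toSeq_basisVec, Pi.single_eq_of_ne h]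

theorem toSeq_basisVec_self (n : ℕ) : (basisVec n : JamesSpace r).toSeq n = 1 := by
  rw [toSeq_basisVec, Pi.single_eq_same]

theorem toSeq_listVec_of_interlaced {b : ℕ} {l m : List ℕ} (h : Interlaced b l m) :
    (∀ i < b, (listVec r l).toSeq i = 0) ∧ ∀ i < b, (listVec r m).toSeq i = 0 := by
  induction h with
  | nil b => exact ⟨fun _ _ => rfl, fun _ _ => rfl⟩
  | cons hb hnm h ih =>
    refine ⟨fun i hi => ?_, fun i hi => ?_⟩
    · rw [listVec_cons, toSeq_add, Pi.add_apply, toSeq_basisVec_of_ne (by omega),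
        ih.1 i (by omega), add_zero]
    · rw [listVec_cons, toSeq_add, Pi.add_apply, toSeq_basisVec_of_ne (by omega),
        ih.2 i (by omega), add_zero]

theorem smoothNorm_listVec_rpow_le (c : ℝ) {b : ℕ} {l m : List ℕ} (h : Interlaced b l m) :
    smoothNorm r (c • listVec r l) ^ r ≤ l.length * (10 * |c|) ^ r ∧
      smoothNorm r (c • listVec r m) ^ r ≤ m.length * (10 * |c|) ^ r := by
  induction h with
  | nil b => simp [listVec_nil, Real.zero_rpow (exp_pos r).ne']
  | cons hb hnm h ih =>
    have h0 := toSeq_listVec_of_interlaced (r := r) h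
    rw [listVec_cons, listVec_cons, smul_add, smul_add]
    push_cast [List.length_cons]
    refine ⟨(smoothNorm_basisVec_add_rpow_le _ _ (fun i hi => ?_) c).trans ?_,
      (smoothNorm_basisVec_add_rpow_le _ _ (fun i hi => ?_) c).trans ?_⟩
    · rw [toSeq_smul, Pi.smul_apply, h0.1 i (by omega), smul_zero]
    · linarith [ih.1]
    · rw [toSeq_smul, Pi.smul_apply, h0.2 i (by omega), smul_zero]
    · linarith [ih.2]

theorem length_le_norm_tail_rpow {b : ℕ} {l m : List ℕ} (h : Interlaced b l m) :
    (l.length : ℝ) ≤ ‖tail b (listVec r l - listVec r m)‖ ^ r := by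
  induction h with
  | nil b => simp only [List.length_nil, CharP.cast_eq_zero]; positivity
  | @cons b m n l l' hb hnm h ih =>
    have h0 := toSeq_listVec_of_interlaced (r := r) h
    set x := listVec r (n :: l) - listVec r (m :: l') with hx
    have hxi : ∀ i, x.toSeq i = (basisVec n : JamesSpace r).toSeq i + (listVec r l).toSeq i
        - ((basisVec m : JamesSpace r).toSeq i + (listVec r l').toSeq i) := by
      intro i
      rw [hx, listVec_cons, listVec_cons]
      rfl
    have h1 : tail (m + 1) (tail b x) = tail (m + 1) (listVec r l - listVec r l') := by
      rw [tail_tail (by omega)]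
      refine toSeq_injective (funext fun i => ?_)
      have hne : max i (m + 1) ≠ m ∧ max i (m + 1) ≠ n := by omega
      rw [toSeq_tail, toSeq_tail, hxi, toSeq_basisVec_of_ne hne.1, toSeq_basisVec_of_ne hne.2,
        toSeq_sub, Pi.sub_apply, zero_add, zero_add]
    have h2 := norm_head_add_norm_tail_le (m + 1) (tail b x)
    have h3 : 1 ≤ ‖tail b x - tail (m + 1) (tail b x)‖ := by
      have h4 := (tail b x - tail (m + 1) (tail b x)).varLE.abs_sub_le (exp_pos r) n m
      rw [toSeq_sub_tail, toSeq_sub_tail, sub_sub_sub_cancel_right, min_eq_left (by omega),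
        min_eq_left (by omega), toSeq_tail, toSeq_tail, max_eq_left (by omega),
        max_eq_left (by omega), hxi, hxi, h0.1 m (by omega), h0.1 n (by omega),
        h0.2 m (by omega), h0.2 n (by omega), toSeq_basisVec_self, toSeq_basisVec_self,
        toSeq_basisVec_of_ne (by omega), toSeq_basisVec_of_ne (by omega)] at h4
      norm_num at h4
      linarith
    have h5 := Real.one_le_rpow h3 (exp_pos r).le
    rw [h1] at h2 h5
    push_cast [List.length_cons]
    linarith

theorem rpow_length_le_norm_sub {b : ℕ} {l m : List ℕ} (h : Interlaced b l m) :
    (l.length : ℝ) ^ (1 / r) ≤ ‖listVec r l - listVec r m‖ := by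
  have hr0 := exp_pos r
  have h1 := (length_le_norm_tail_rpow (r := r) h).trans
    (Real.rpow_le_rpow (norm_nonneg _) (norm_tail_le b _) hr0.le)
  have h2 := Real.rpow_le_rpow (by positivity) h1 (by positivity : 0 ≤ 1 / r)
  rwa [← Real.rpow_mul (norm_nonneg _), mul_one_div_cancel hr0.ne', Real.rpow_one] at h2

end JamesSpace

open JamesSpace

theorem eventually_rpow_lt {r q A M : ℝ} (hr : 0 < r) (hrq : r < q) (hA : 0 < A) :
    ∀ᶠ k : ℕ in atTop, (k : ℝ) ^ (1 / q) * M < A * (k : ℝ) ^ (1 / r) := by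
  have hpos : 0 < 1 / r - 1 / q := sub_pos.2 (one_div_lt_one_div_of_lt hr hrq)
  have h1 := (tendsto_rpow_atTop hpos).comp tendsto_natCast_atTop_atTop
  filter_upwards [h1.eventually_gt_atTop (M / A), eventually_gt_atTop 0] with k hk hk0
  have hk0' : (0 : ℝ) < k := by exact_mod_cast hk0
  have h2 : M < (k : ℝ) ^ (1 / r - 1 / q) * A := (div_lt_iff₀ hA).1 hk
  have h3 : (k : ℝ) ^ (1 / r) = (k : ℝ) ^ (1 / q) * (k : ℝ) ^ (1 / r - 1 / q) := by
    rw [← Real.rpow_add hk0', add_sub_cancel]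
  have h4 := mul_lt_mul_of_pos_left h2 (Real.rpow_pos_of_pos hk0' (1 / q))
  rw [h3]
  linarith

/-- A large-scale Lipschitz map of `J_r` into the sum of a space that is asymptotically uniformly
convex of power type `s < r` and of finitely many spaces `J_p` with `p > r` is not bounded below
at large distances. -/
theorem not_large_scale_bounded_below {r s : ℝ} [Fact (1 < r)] (hs : 1 ≤ s) (hsr : s < r)
    {Z : Type*} [AddCommGroup Z] [Module ℝ Z] {ν : Seminorm ℝ Z} {Q : ℕ → Z →ₗ[ℝ] Z}
    (hZ : AsymptoticallyConvex s ν Q) {ι : Type*} [Finite ι] {p : ι → ℝ} [∀ i, Fact (1 < p i)]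
    (hp : ∀ i, r < p i) (g : JamesSpace r → Z) (h : ∀ i, JamesSpace r → JamesSpace (p i))
    {θ A B C : ℝ} (hA : 0 < A) (hB : 0 ≤ B) (hC : 0 ≤ C)
    (hg : ∀ x y, ν (g x - g y) ≤ B * ‖x - y‖ + C)
    (hh : ∀ i x y, ‖h i x - h i y‖ ≤ B * ‖x - y‖ + C)
    (hlow : ∀ x y, θ ≤ ‖x - y‖ →
      A * ‖x - y‖ ≤ ν (g x - g y) ∨ ∃ i, A * ‖x - y‖ ≤ ‖h i x - h i y‖) : False := by
  have hr0 := exp_pos r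
  set M := 5 * (4 * B + C) with hM
  obtain ⟨k, hk, hk1⟩ := ((eventually_all.2 fun i =>
    eventually_rpow_lt (M := 2 * M + 1) hr0 (hp i) hA).and (eventually_ge_atTop 1)).exists
  have hk1' : (1 : ℝ) ≤ k := by exact_mod_cast hk1
  set κ := (k : ℝ) ^ (1 / r) with hκ
  have hκ1 : 1 ≤ κ := Real.one_le_rpow hk1' (by positivity)
  obtain ⟨ρ, x₀, N₀, R, c, hρ, hρ0, hball⟩ := exists_ball_tail_le hs hsr hZ g (θ := 1) (B := B + C)
    (fun x y hxy => by
      have h1 := norm_le_smoothNorm (x - y)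
      have h2 := mul_le_mul_of_nonneg_left h1 hB
      have h3 := mul_le_mul_of_nonneg_left hxy hC
      linarith [hg x y]) (by positivity : 0 < A / 40) (10 * κ * max 1 θ)
  obtain ⟨σ, hσ⟩ : ∃ σ, ρ = 10 * κ * σ := ⟨ρ / (10 * κ), by field_simp⟩
  have hσ' : max 1 θ ≤ σ := by
    rw [hσ] at hρ
    exact le_of_mul_le_mul_left hρ (by positivity)
  have hσ1 : 1 ≤ σ := (le_max_left _ _).trans hσ'
  have hσθ : θ ≤ σ := (le_max_right _ _).trans hσ'
  set φ : List ℕ → JamesSpace r := fun l => x₀ + σ • listVec r l with hφ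
  have hφ0 : ∀ l, ‖φ l - x₀‖ ≤ σ * (2 * l.length) := fun l => by
    rw [hφ, add_sub_cancel_left, norm_smul, Real.norm_eq_abs, abs_of_pos (by linarith)]
    exact mul_le_mul_of_nonneg_left (norm_listVec_le l) (by linarith)
  have hφsub : ∀ l m, φ l - φ m = σ • (listVec r l - listVec r m) := fun l m => by
    simp only [hφ]; module
  obtain ⟨κι, _, co, D, hD, hco, hhead⟩ := hZ.finite_rank R
  set η := A / 40 * ρ / (2 * (D * Fintype.card κι + 1)) with hη
  have hη0 : 0 < η := by positivity
  obtain ⟨l, m, hlm, hl, hm, hPl, hPm, hend⟩ := exists_interlaced (ι := ι) (p := p)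
    (L := fun _ => M * σ) (fun i => (one_lt (p i)).le) (by linarith : 0 < σ) k N₀
    (fun i l => (h i (φ l)).toSeq)
    (fun l => ∀ j, |co j (g (φ l)) - iterLim k fun l => co j (g (φ l))| ≤ η)
    (fun i k => ⟨B * (σ * (2 * k)) + C + ‖h i x₀‖, fun l hl t => by
      refine (abs_apply_le _ t).trans ?_
      have h1 := hh i (φ l) x₀
      have h2 := mul_le_mul_of_nonneg_left (hφ0 l) hB
      have h3 := norm_le_norm_sub_add (h i (φ l)) (h i x₀)
      rw [hl] at h2
      linarith⟩)
    (fun i l₁ m n l₂ => by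
      have h1 := hh i (φ (l₁ ++ m :: l₂)) (φ (l₁ ++ n :: l₂))
      rw [hφsub, listVec_append_cons_sub, norm_smul, Real.norm_eq_abs,
        abs_of_pos (by linarith)] at h1
      have h2 := norm_sub_le (basisVec m : JamesSpace r) (basisVec n)
      have h3 : ‖(basisVec m : JamesSpace r) - basisVec n‖ ≤ 4 := by
        linarith [norm_basisVec_le (p := r) m, norm_basisVec_le (p := r) n]
      have h4 : B * (σ * ‖(basisVec m : JamesSpace r) - basisVec n‖) ≤ B * (σ * 4) := by
        gcongr
      have h5 : C ≤ C * σ := le_mul_of_one_le_right hC hσ1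
      refine (endVarLE (h i (φ (l₁ ++ m :: l₂)) - h i (φ (l₁ ++ n :: l₂)))).mono
        (exp_pos (p i)).le ?_
      rw [hM]
      linarith)
    (generic_all fun j => generic_abs_sub_iterLim_le
      (K := D * (B * (σ * (2 * k)) + C + ν (g x₀))) (fun l hl => by
        refine (hco j _).trans (mul_le_mul_of_nonneg_left ?_ hD)
        have h1 := hg (φ l) x₀
        have h2 := mul_le_mul_of_nonneg_left (hφ0 l) hB
        have h3 := map_add_le_add ν (g (φ l) - g x₀) (g x₀)
        rw [sub_add_cancel] at h3
        rw [hl] at h2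
        linarith) hη0)
  have hdist : σ * κ ≤ ‖φ l - φ m‖ := by
    rw [hφsub, norm_smul, Real.norm_eq_abs, abs_of_pos (by linarith)]
    have := rpow_length_le_norm_sub (r := r) hlm
    rw [hl] at this
    exact mul_le_mul_of_nonneg_left this (by linarith)
  have hσκ : σ ≤ σ * κ := le_mul_of_one_le_right (by linarith) hκ1
  have hAσκ : 0 < A * (σ * κ) := by positivity
  have hAdist := mul_le_mul_of_nonneg_left hdist hA.le
  rcases hlow (φ l) (φ m) (by linarith) with hcase | ⟨i, hcase⟩
  · have hz := toSeq_listVec_of_interlaced (r := r) hlm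
    have hn := smoothNorm_listVec_rpow_le (r := r) σ hlm
    have hrad : (k : ℝ) * (10 * |σ|) ^ r = ρ ^ r := by
      have h1 : ρ = κ * (10 * σ) := by rw [hσ]; ring
      rw [h1, abs_of_pos (by linarith), Real.mul_rpow (x := κ) (by positivity) (by positivity), hκ,
        ← Real.rpow_mul (by positivity), one_div_mul_cancel hr0.ne', Real.rpow_one]
    rw [hl, hm, hrad, Real.rpow_le_rpow_iff (apply_nonneg _ _) hρ0.le hr0,
      Real.rpow_le_rpow_iff (apply_nonneg _ _) hρ0.le hr0] at hn
    have hT1 := hball (σ • listVec r l) (fun i hi => by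
      rw [toSeq_smul, Pi.smul_apply, hz.1 i hi, smul_zero]) hn.1
    have hT2 := hball (σ • listVec r m) (fun i hi => by
      rw [toSeq_smul, Pi.smul_apply, hz.2 i hi, smul_zero]) hn.2
    have hT : ν (Q R (g (φ l) - g (φ m))) ≤ A / 40 * ρ + A / 40 * ρ := by
      have h1 : Q R (g (φ l) - g (φ m)) = Q R (g (φ l) - c) - Q R (g (φ m) - c) := by
        rw [← map_sub, sub_sub_sub_cancel_right]
      rw [h1]
      exact (map_sub_le_add ν _ _).trans (add_le_add hT1 hT2)
    have hH : ν ((g (φ l) - g (φ m)) - Q R (g (φ l) - g (φ m))) ≤ A / 40 * ρ := by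
      refine (hhead _).trans ?_
      have h1 : ∑ j, |co j (g (φ l) - g (φ m))| ≤ Fintype.card κι * (2 * η) := by
        rw [← nsmul_eq_mul, ← Finset.card_univ, ← Finset.sum_const]
        refine Finset.sum_le_sum fun j _ => ?_
        rw [map_sub]
        have h2 := abs_le.1 (hPl j)
        have h3 := abs_le.1 (hPm j)
        exact abs_le.2 ⟨by linarith [h2.1, h3.2], by linarith [h2.2, h3.1]⟩
      have h4 : D * (Fintype.card κι * (2 * η))
          = A / 40 * ρ * (D * Fintype.card κι / (D * Fintype.card κι + 1)) := by
        rw [hη]; field_simp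
      refine (mul_le_mul_of_nonneg_left h1 hD).trans ?_
      rw [h4]
      exact mul_le_of_le_one_right (by positivity) ((div_le_one (by positivity)).2 (by linarith))
    have h5 := map_add_le_add ν ((g (φ l) - g (φ m)) - Q R (g (φ l) - g (φ m)))
      (Q R (g (φ l) - g (φ m)))
    rw [sub_add_cancel] at h5
    have h6 : A / 40 * ρ = A * (σ * κ) / 4 := by rw [hσ]; ring
    linarith
  · have h1 : ‖h i (φ l) - h i (φ m)‖ ≤ (k : ℝ) ^ (1 / p i) * (2 * (M * σ)) + σ :=
      norm_le_iff.2 (hend i).varLE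
    have h2 : 1 ≤ (k : ℝ) ^ (1 / p i) :=
      Real.one_le_rpow hk1' (by have := exp_pos (p i); positivity)
    have h3 := mul_lt_mul_of_pos_right (hk i) (by linarith : 0 < σ)
    have h4 := mul_le_mul_of_nonneg_right h2 (by linarith : 0 ≤ σ)
    linarith

/-- A map that is Lipschitz at large distances from `J_r` is Lipschitz up to an additive
constant. -/
theorem norm_sub_le_of_large_scale {r : ℝ} [Fact (1 < r)] {Y : Type*} [NormedAddCommGroup Y]
    {f : JamesSpace r → Y} {θ B : ℝ} (hθ : 0 < θ) (hB : 0 < B)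
    (hf : ∀ x y, θ ≤ ‖x - y‖ → ‖f x - f y‖ ≤ B * ‖x - y‖) (x y : JamesSpace r) :
    ‖f x - f y‖ ≤ B * ‖x - y‖ + 9 * (B * θ) := by
  have hBθ : 0 < B * θ := by positivity
  rcases le_or_gt θ ‖x - y‖ with h | h
  · linarith [hf x y h]
  set e : JamesSpace r := (2 * θ) • basisVec 0 with he
  have he1 : 2 * θ ≤ ‖e‖ := by
    have h1 := (basisVec 0 : JamesSpace r).abs_apply_le 0
    rw [toSeq_basisVec_self, abs_one] at h1
    rw [he, norm_smul, Real.norm_eq_abs, abs_of_pos (by positivity)]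
    exact le_mul_of_one_le_right (by positivity) h1
  have he2 : ‖e‖ ≤ 4 * θ := by
    rw [he, norm_smul, Real.norm_eq_abs, abs_of_pos (by positivity)]
    have := mul_le_mul_of_nonneg_left (norm_basisVec_le (p := r) 0)
      (by positivity : 0 ≤ 2 * θ)
    linarith
  have hx : x + e - x = e := add_sub_cancel_left x e
  have hy : x + e - y = (x - y) + e := by abel
  have h1 := hf (x + e) x (by rw [hx]; linarith)
  rw [hx] at h1
  have hy1 : ‖e‖ - ‖x - y‖ ≤ ‖x - y + e‖ := by
    have := norm_sub_le (x - y + e) (x - y)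
    rw [add_sub_cancel_left] at this
    linarith
  have hy2 := norm_add_le (x - y) e
  have h2 := hf (x + e) y (by rw [hy]; linarith)
  rw [hy] at h2
  have h3 : f x - f y = (f (x + e) - f y) - (f (x + e) - f x) := by abel
  have h4 := norm_sub_le (f (x + e) - f y) (f (x + e) - f x)
  rw [h3]
  have h5 := mul_le_mul_of_nonneg_left he2 hB.le
  have h6 := mul_le_mul_of_nonneg_left (hy2.trans (by linarith : _ ≤ 5 * θ)) hB.le
  have h7 := mul_nonneg hB.le (norm_nonneg (x - y))
  linarith

end

theorem mainTheorem1 (p q r : ℝ) [Fact (1 < p)] [Fact (1 < q)] [Fact (1 < r)]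
    (hpq : p < q) (hrp : r ≠ p) (hrq : r ≠ q) :
    ¬ CoarseLipschitzEmbeds (JamesSpace r) (JamesSpace p × JamesSpace q) := by
  rintro ⟨f, θ, A, B, hθ, hA, hB, hf⟩
  simp only [dist_eq_norm] at hf
  have hup := norm_sub_le_of_large_scale hθ hB fun x y hxy => (hf x y hxy).2
  have hup1 : ∀ x y, ‖(f x).1 - (f y).1‖ ≤ B * ‖x - y‖ + 9 * (B * θ) :=
    fun x y => (norm_fst_le (f x - f y)).trans (hup x y)
  have hup2 : ∀ x y, ‖(f x).2 - (f y).2‖ ≤ B * ‖x - y‖ + 9 * (B * θ) :=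
    fun x y => (norm_snd_le (f x - f y)).trans (hup x y)
  have hlow : ∀ x y, θ ≤ ‖x - y‖ →
      A * ‖x - y‖ ≤ ‖(f x).1 - (f y).1‖ ∨ A * ‖x - y‖ ≤ ‖(f x).2 - (f y).2‖ :=
    fun x y hxy => le_max_iff.1 (hf x y hxy).1
  have hC : 0 ≤ 9 * (B * θ) := by positivity
  rcases lt_or_gt_of_ne hrp with h1 | h1
  · have : ∀ b : Bool, Fact (1 < (bif b then p else q)) := fun b => by
      cases b <;> simpa
    refine not_large_scale_bounded_below (r := r) le_rfl (JamesSpace.one_lt r)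
      (asymptoticallyConvex_zero (Z := PUnit.{1})) (ι := Bool) (p := fun b => bif b then p else q)
      (fun b => by cases b <;> simp <;> linarith) (fun _ => 0)
      (fun b => match b with
        | true => fun x => (f x).1
        | false => fun x => (f x).2) (θ := θ) hA hB.le hC
      (fun x y => by simpa using by positivity) ?_ ?_
    · rintro (_ | _) x y
      · exact hup2 x y
      · exact hup1 x y
    · intro x y hxy
      rcases hlow x y hxy with h | h
      · exact Or.inr ⟨true, h⟩
      · exact Or.inr ⟨false, h⟩
  rcases lt_or_gt_of_ne hrq with h2 | h2
  · refine not_large_scale_bounded_below (r := r) (JamesSpace.one_lt p).le h1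
      (asymptoticallyConvex_james (le_refl p)) (ι := Unit) (p := fun _ => q) (fun _ => h2)
      (fun x => (f x).1) (fun _ x => (f x).2) (θ := θ) hA hB.le hC hup1 (fun _ => hup2) ?_
    intro x y hxy
    exact (hlow x y hxy).imp id fun h => ⟨(), h⟩
  · have : ∀ b : Empty, Fact (1 < (fun b : Empty => (b.elim : ℝ)) b) := fun b => b.elim
    refine not_large_scale_bounded_below (r := r) (JamesSpace.one_lt q).le h2
      ((asymptoticallyConvex_james hpq.le).prod (JamesSpace.one_lt q).le
        (asymptoticallyConvex_james (le_refl q))) (ι := Empty) (p := fun b => b.elim)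
      (fun b => b.elim) f (fun b => b.elim) (θ := θ) hA
      (B := B + B) (C := 9 * (B * θ) + 9 * (B * θ)) (by linarith) (by linarith) ?_
      (fun b => b.elim) ?_
    · intro x y
      refine (lpSumSeminorm_le _ _ _ _).trans ?_
      have h3 := hup1 x y
      have h4 := hup2 x y
      simp only [coe_normSeminorm, Prod.fst_sub, Prod.snd_sub]
      linarith
    · intro x y hxy
      left
      rcases hlow x y hxy with h | h
      · exact h.trans (le_lpSumSeminorm_fst _ (normSeminorm ℝ (JamesSpace p))
          (normSeminorm ℝ (JamesSpace q)) (f x - f y))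
      · exact h.trans (le_lpSumSeminorm_snd _ (normSeminorm ℝ (JamesSpace p))
          (normSeminorm ℝ (JamesSpace q)) (f x - f y))
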